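/- Let $0<\beta<1$. Let $V:\mathbb{R}^3\to\mathbb{R}$ be continuous and strictly positive with $V(r)\to\infty$ as $|r|\to\infty$, and let $v_0:\mathbb{R}^3\to\mathbb{R}$ be smooth, compactly supported, non-negative and spherically symmetric. For $N\ge 2$ put $$v_N(r)=\frac{N^{3\beta}}{N-1}\,v_0(N^\beta r),\qquad g=\frac12\int_{\mathbb{R}^3}v_0(r)\,dr .$$ For $a,b\in\mathbb{R}$, and for permutation-symmetric $\Psi\in H^1(\mathbb{R}^{3N};\mathbb{C})$ and $\phi\in H^1(\mathbb{R}^3;\mathbb{C})$ of $L^2$-norm $1$ and finite energy, let $$\mathcal{E}_N^{a,b}(\Psi)=\int_{\mathbb{R}^{3N}}\Big(\sum_{i=1}^N\big(|\nabla_i\Psi|^2+a\,V(r_i)|\Psi|^2\big)+b\sum_{1\le i<j\le N}v_N(r_i-r_j)|\Psi|^2\Big)dr_1\cdots dr_N,$$ $$\mathcal{E}_{nlS}^{a,b}(\phi)=\int_{\mathbb{R}^3}\big(|\nabla\phi|^2+a\,V|\phi|^2+b\,g|\phi|^4\big)dr,$$ and let $E_N^{a,b}$ and $E_{nlS}^{a,b}$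 be the infima of these functionals over such normalized $\Psi$ and $\phi$. Assume that for all $\lambda$ in a neighbourhood of $1$: (A) $\lim_{N\to\infty}E_N^{\lambda,1}/N=E_{nlS}^{\lambda,1}$ and $\lim_{N\to\infty}E_N^{1,\lambda}/N=E_{nlS}^{1,\lambda}$; (U) $\mathcal{E}_{nlS}^{\lambda,1}$ and $\mathcal{E}_{nlS}^{1,\lambda}$ each have a minimizer, which is unique up to a constant phase. For $N\ge2$ let $\Psi_N$ be a minimizer of $\mathcal{E}_N^{1,1}$, and let $\phi_{nlS}$ be the minimizer of $\mathcal{E}_{nlS}^{1,1}$. Then, as $N\to\infty$, $$\int_{\mathbb{R}^{3N}}|\nabla_1\Psi_N|^2\,dr_1\cdots dr_N\to\int_{\mathbb{R}^3}|\nabla\phi_{nlS}|^2\,dr,$$ $$\int_{\mathbb{R}^{3N}}V(r_1)|\Psi_N|^2\,dr_1\cdots dr_N\to\int_{\mathbb{R}^3}V|\phi_{nlS}|^2\,dr,$$ $$\frac12\sum_{j=2}^N\int_{\mathbb{R}^{3N}}v_N(r_1-r_j)|\Psi_N|^2\,dr_1\cdots dr_N\to g\int_{\mathbb{R}^3}|\phi_{nlS}|^4\,dr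 .$$ -/

import Mathlib

open MeasureTheory Filter Topology
open scoped ContDiff

namespace BoseGas

noncomputable section

/-- Physical space `ℝ³` with its Euclidean norm. -/
abbrev R3 : Type := EuclideanSpace ℝ (Fin 3)

/-- The configuration space `ℝ^{3N}` of `N` particles, with Lebesgue measure. -/
abbrev Config (N : ℕ) : Type := Fin N → R3

section Sobolev

variable {E : Type*} [NormedAddCommGroup E] [NormedSpace ℝ E] [MeasureSpace E]

/-- `g` is the weak (distributional) derivative of `f` in the direction `u`, tested against all
smooth compactly supported functions. (Used for `f, g ∈ L²`, where all the integrals converge.) -/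
def IsWeakDeriv (f g : E → ℂ) (u : E) : Prop :=
  ∀ η : E → ℝ, ContDiff ℝ ∞ η → HasCompactSupport η →
    ∫ x, (fderiv ℝ η x u) • f x = - ∫ x, η x • g x

/-- The complex Sobolev space `H¹`: `f` and all its first weak derivatives are in `L²`. -/
def MemH1 (f : E → ℂ) : Prop :=
  MemLp f 2 volume ∧ ∀ u : E, ∃ g : E → ℂ, MemLp g 2 volume ∧ IsWeakDeriv f g u

open Classical in
/-- The weak derivative of `f` in the direction `u` (a representative of it, which is unique up to
a null set; the value is `0` if `f` has no weak derivative in `L²` in that direction). -/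
def weakDeriv (f : E → ℂ) (u : E) : E → ℂ :=
  if h : ∃ g : E → ℂ, MemLp g 2 volume ∧ IsWeakDeriv f g u then h.choose else 0

end Sobolev

/-! ### One-particle (nonlinear Schrödinger) functional -/

/-- The `k`-th coordinate direction in `ℝ³`. -/
def coordDir (k : Fin 3) : R3 := EuclideanSpace.single k 1

/-- `∫ |∇φ|²`. -/
def kinetic (φ : R3 → ℂ) : ℝ := ∫ x, ∑ k : Fin 3, ‖weakDeriv φ (coordDir k) x‖ ^ 2

/-- `∫ V |φ|²`. -/
def potential (V : R3 → ℝ) (φ : R3 → ℂ) : ℝ := ∫ x, V x * ‖φ x‖ ^ 2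

/-- `∫ |φ|⁴`. -/
def quartic (φ : R3 → ℂ) : ℝ := ∫ x, ‖φ x‖ ^ 4

/-- `a` multiplies the external potential and `b` multiplies the nonlinear term:
`∫ (|∇φ|² + a V |φ|² + b g |φ|⁴)`. -/
def nlsEnergy (V : R3 → ℝ) (g a b : ℝ) (φ : R3 → ℂ) : ℝ :=
  kinetic φ + a * potential V φ + b * (g * quartic φ)

/-- The normalized `φ ∈ H¹(ℝ³)` of finite energy. -/
def nlsStates (V : R3 → ℝ) : Set (R3 → ℂ) :=
  {φ | MemH1 φ ∧ ∫ x, ‖φ x‖ ^ 2 = 1 ∧ Integrable (fun x => V x * ‖φ x‖ ^ 2) ∧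
    Integrable (fun x => ‖φ x‖ ^ 4)}

/-- The minimal energy of `nlsEnergy V g a b`. -/
def nlsMinEnergy (V : R3 → ℝ) (g a b : ℝ) : ℝ := sInf (nlsEnergy V g a b '' nlsStates V)

/-- `φ` minimizes `nlsEnergy V g a b` among the normalized states of finite energy. -/
def IsNlsMinimizer (V : R3 → ℝ) (g a b : ℝ) (φ : R3 → ℂ) : Prop :=
  φ ∈ nlsStates V ∧ IsMinOn (nlsEnergy V g a b) (nlsStates V) φ

/-- There is a minimizer of `nlsEnergy V g a b`, and it is unique up to a constant phase (and up to
equality almost everywhere). -/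
def HasUniqueNlsMinimizer (V : R3 → ℝ) (g a b : ℝ) : Prop :=
  (∃ φ, IsNlsMinimizer V g a b φ) ∧
  ∀ φ ψ, IsNlsMinimizer V g a b φ → IsNlsMinimizer V g a b ψ →
    ∃ c : ℂ, ‖c‖ = 1 ∧ ψ =ᵐ[volume] fun x => c * φ x

/-! ### `N`-body functional -/

/-- The scaled pair interaction `v_N(r) = N^{3β} / (N - 1) · v₀(N^β r)`. -/
def pairPotential (β : ℝ) (v₀ : R3 → ℝ) (N : ℕ) (r : R3) : ℝ :=
  (N : ℝ) ^ (3 * β) / ((N : ℝ) - 1) * v₀ ((N : ℝ) ^ β • r)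

/-- The coupling constant `g = ½ ∫ v₀`, for which the functional `nlsEnergy V g 1 1` is the
mean-field limit of the energy per particle of `nBodyEnergy`. -/
def coupling (v₀ : R3 → ℝ) : ℝ := (1 / 2) * ∫ x, v₀ x

/-- `∫ |∇_i Ψ|²`, the kinetic energy of the particle `i`. -/
def kineticAt {N : ℕ} (Ψ : Config N → ℂ) (i : Fin N) : ℝ :=
  ∫ X, ∑ k : Fin 3, ‖weakDeriv Ψ (Pi.single i (coordDir k)) X‖ ^ 2

/-- `∫ V(r_i) |Ψ|²`, the potential energy of the particle `i`. -/
def potentialAt {N : ℕ} (V : R3 → ℝ) (Ψ : Config N → ℂ) (i : Fin N) : ℝ :=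
  ∫ X, V (X i) * ‖Ψ X‖ ^ 2

/-- `∫ v(r_i - r_j) |Ψ|²`, the interaction energy of the particles `i` and `j`. -/
def interactionAt {N : ℕ} (v : R3 → ℝ) (Ψ : Config N → ℂ) (i j : Fin N) : ℝ :=
  ∫ X, v (X i - X j) * ‖Ψ X‖ ^ 2

/-- The energy of `N` particles with external potential `a V` and pair interaction `b v`:
`∑_i (∫ |∇_i Ψ|² + a ∫ V(r_i) |Ψ|²) + b ∑_{i < j} ∫ v(r_i - r_j) |Ψ|²`. -/
def nBodyEnergy {N : ℕ} (V v : R3 → ℝ) (a b : ℝ) (Ψ : Config N → ℂ) : ℝ :=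
  (∑ i : Fin N, (kineticAt Ψ i + a * potentialAt V Ψ i)) +
    b * ∑ i : Fin N, ∑ j ∈ Finset.Ioi i, interactionAt v Ψ i j

/-- The normalized permutation-symmetric `Ψ ∈ H¹(ℝ^{3N})` of finite energy. -/
def nBodyStates (N : ℕ) (V v : R3 → ℝ) : Set (Config N → ℂ) :=
  {Ψ | MemH1 Ψ ∧ ∫ X, ‖Ψ X‖ ^ 2 = 1 ∧
    (∀ σ : Equiv.Perm (Fin N), (fun X : Config N => Ψ (X ∘ σ)) =ᵐ[volume] Ψ) ∧
    (∀ i : Fin N, Integrable (fun X : Config N => V (X i) * ‖Ψ X‖ ^ 2)) ∧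
    (∀ i j : Fin N, i < j → Integrable (fun X : Config N => v (X i - X j) * ‖Ψ X‖ ^ 2))}

/-- The minimal energy of `N` bosons. -/
def nBodyMinEnergy (N : ℕ) (V v : R3 → ℝ) (a b : ℝ) : ℝ :=
  sInf (nBodyEnergy V v a b '' nBodyStates N V v)

/-- `Ψ` is a ground state of `N` bosons with external potential `V` and pair interaction `v`. -/
def IsGroundState {N : ℕ} (V v : R3 → ℝ) (Ψ : Config N → ℂ) : Prop :=
  Ψ ∈ nBodyStates N V v ∧ IsMinOn (nBodyEnergy V v 1 1) (nBodyStates N V v) Ψ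

/-! ### Assumptions -/

/-- The confining potential is continuous, strictly positive, and tends to infinity at infinity. -/
structure IsConfining (V : R3 → ℝ) : Prop where
  continuous : Continuous V
  pos : ∀ x, 0 < V x
  tendsto : Tendsto V (cocompact R3) atTop

/-- The interaction is smooth, compactly supported, non-negative and spherically symmetric. -/
structure IsRepulsiveInteraction (v₀ : R3 → ℝ) : Prop where
  smooth : ContDiff ℝ ∞ v₀
  compactSupport : HasCompactSupport v₀
  nonneg : ∀ x, 0 ≤ v₀ x
  radial : ∀ x y, ‖x‖ = ‖y‖ → v₀ x = v₀ y

/-- Convergence, for all `lam` near `1`, of the minimal energies per particle, with `lam` in front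
of the external potential (first part) and in front of the interaction (second part). -/
def EnergyConvergence (β : ℝ) (V v₀ : R3 → ℝ) : Prop :=
  (∀ᶠ lam in 𝓝 (1 : ℝ),
    Tendsto (fun N : ℕ => nBodyMinEnergy N V (pairPotential β v₀ N) lam 1 / N) atTop
      (𝓝 (nlsMinEnergy V (coupling v₀) lam 1))) ∧
  (∀ᶠ lam in 𝓝 (1 : ℝ),
    Tendsto (fun N : ℕ => nBodyMinEnergy N V (pairPotential β v₀ N) 1 lam / N) atTop
      (𝓝 (nlsMinEnergy V (coupling v₀) 1 lam)))

end

end BoseGas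

/-! The argument is of Feynman–Hellmann type. Put e_N(λ) = E_N^{λ,1}/N and E(λ) = E_nlS^{λ,1}, and
let P_N be the potential energy of one particle in Ψ_N. With Ψ_N as trial state at λ, symmetry
(`nBodyEnergy_eq`) gives e_N(λ) ≤ e_N(1) + (λ - 1) P_N. With a minimizer F_λ at λ as trial state at
1, E(1) + (λ - 1) q(λ) ≤ E(λ), where q(λ) = ∫ V|F_λ|². By (A) the differences of e_N converge to
those of E, so liminf P_N ≥ q(λ) for λ > 1 and limsup P_N ≤ q(λ) for λ < 1. Continuity of q at 1
then forces convergence (`tendsto_supergradient`). The same argument with λ on the interaction gives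
the third limit, and the kinetic energy is the total minus the other two.

Continuity of q comes from compactness. As λ → 1 the F_λ minimize the functional at λ = 1
asymptotically (`exists_supergradient`). Bounded kinetic and potential energy make a sequence
precompact in L², since V → ∞ keeps mass from escaping; all three energy terms are lower
semicontinuous along a subsequence (`exists_subseq_lower_semicontinuous`). Hence the limit is a
minimizer, equal to φ up to a phase by uniqueness, and lower semicontinuous terms whose sum
converges must converge separately (`tendsto_of_minimizing_sequence`). The compactness rests on
mollification (`tendsto_eLpNorm_of_L2WeakTendsto_zero`); the Sobolev embedding `MemH1.memLp_six`
keeps the quartic term of the limit finite. -/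

namespace BoseGas

open scoped Convolution ENNReal
open ContinuousLinearMap (lsmul)

set_option linter.unusedSectionVars false

/-! ### Calculus of weak derivatives in L². -/

section WeakDerivative

variable {E : Type*} [NormedAddCommGroup E] [NormedSpace ℝ E] [MeasureSpace E]

theorem enorm_integral_smul_le {η : E → ℝ} {f : E → ℂ}
    (hη : AEStronglyMeasurable η) (hf : AEStronglyMeasurable f) :
    ‖∫ x, η x • f x‖ₑ ≤ eLpNorm η 2 volume * eLpNorm f 2 volume := by
  refine (enorm_integral_le_lintegral_enorm _).trans ?_
  have h := eLpNorm_smul_le_mul_eLpNorm (p := 2) (q := 2) (r := 1) hf hη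
  rwa [eLpNorm_one_eq_lintegral_enorm] at h

theorem IsWeakDeriv.congr_ae {f f' g g' : E → ℂ} {u : E} (h : IsWeakDeriv f g u)
    (hf : f =ᵐ[volume] f') (hg : g =ᵐ[volume] g') : IsWeakDeriv f' g' u := by
  intro η hη hc
  have h1 : ∫ x, (fderiv ℝ η x u) • f' x = ∫ x, (fderiv ℝ η x u) • f x :=
    integral_congr_ae (by filter_upwards [hf] with x hx; rw [hx])
  have h2 : ∫ x, η x • g' x = ∫ x, η x • g x :=
    integral_congr_ae (by filter_upwards [hg] with x hx; rw [hx])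
  rw [h1, h2, h η hη hc]

variable [BorelSpace E] [FiniteDimensional ℝ E] [IsLocallyFiniteMeasure (volume : Measure E)]

theorem _root_.MeasureTheory.MemLp.locallyIntegrable_two {f : E → ℂ} (hf : MemLp f 2 volume) :
    LocallyIntegrable f :=
  hf.locallyIntegrable (by norm_num)

/-- Fundamental lemma of the calculus of variations. Since `weakDeriv` is a choice, this is how it
gets identified with derivatives constructed otherwise. -/
theorem IsWeakDeriv.unique {f g g' : E → ℂ} {u : E} (h : IsWeakDeriv f g u)
    (h' : IsWeakDeriv f g' u) (hg : MemLp g 2 volume) (hg' : MemLp g' 2 volume) :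
    g =ᵐ[volume] g' := by
  refine ae_eq_of_integral_contDiff_smul_eq hg.locallyIntegrable_two hg'.locallyIntegrable_two
    fun η hη hc => ?_
  have := (h η hη hc).symm.trans (h' η hη hc)
  simpa using this

theorem integrable_fderiv_smul {f : E → ℂ} (hf : LocallyIntegrable f) {η : E → ℝ}
    (hη : ContDiff ℝ ∞ η) (hc : HasCompactSupport η) (u : E) :
    Integrable fun x => (fderiv ℝ η x u) • f x :=
  hf.integrable_smul_left_of_hasCompactSupport
    ((hη.continuous_fderiv (by simp)).clm_apply continuous_const)
    (hc.fderiv_apply (𝕜 := ℝ) u)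

theorem integrable_test_smul {f : E → ℂ} (hf : LocallyIntegrable f) {η : E → ℝ}
    (hη : ContDiff ℝ ∞ η) (hc : HasCompactSupport η) :
    Integrable fun x => η x • f x :=
  hf.integrable_smul_left_of_hasCompactSupport hη.continuous hc

theorem IsWeakDeriv.sub {f g f' g' : E → ℂ} {u : E} (h : IsWeakDeriv f g u)
    (h' : IsWeakDeriv f' g' u) (hf : MemLp f 2 volume) (hg : MemLp g 2 volume)
    (hf' : MemLp f' 2 volume) (hg' : MemLp g' 2 volume) :
    IsWeakDeriv (f - f') (g - g') u := by
  intro η hη hc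
  simp only [Pi.sub_apply, smul_sub]
  rw [integral_sub (integrable_fderiv_smul (hf.locallyIntegrable_two) hη hc u)
      (integrable_fderiv_smul (hf'.locallyIntegrable_two) hη hc u),
    integral_sub (integrable_test_smul (hg.locallyIntegrable_two) hη hc)
      (integrable_test_smul (hg'.locallyIntegrable_two) hη hc), h η hη hc, h' η hη hc]
  ring

theorem IsWeakDeriv.sum_smul {ι : Type*} (s : Finset ι) {f : E → ℂ} {g : ι → E → ℂ} {u : ι → E}
    (c : ι → ℝ) (hf : MemLp f 2 volume) (hg : ∀ i, MemLp (g i) 2 volume)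
    (h : ∀ i, IsWeakDeriv f (g i) (u i)) :
    IsWeakDeriv f (fun x => ∑ i ∈ s, c i • g i x) (∑ i ∈ s, c i • u i) := by
  intro η hη hc
  have h1 : ∀ x, (fderiv ℝ η x (∑ i ∈ s, c i • u i)) • f x
      = ∑ i ∈ s, c i • ((fderiv ℝ η x (u i)) • f x) := by
    intro x
    simp only [map_sum, map_smul, Finset.sum_smul, smul_assoc]
  have h2 : ∀ x, η x • ∑ i ∈ s, c i • g i x = ∑ i ∈ s, c i • (η x • g i x) := by
    intro x
    rw [Finset.smul_sum]
    exact Finset.sum_congr rfl fun i _ => smul_comm _ _ _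
  simp only [h1, h2]
  rw [integral_finsetSum _ fun i _ =>
      (integrable_fderiv_smul (hf.locallyIntegrable_two) hη hc (u i)).fun_smul (c i),
    integral_finsetSum _ fun i _ =>
      (integrable_test_smul ((hg i).locallyIntegrable_two) hη hc).fun_smul (c i),
    ← Finset.sum_neg_distrib]
  refine Finset.sum_congr rfl fun i _ => ?_
  rw [integral_smul, integral_smul, h i η hη hc, smul_neg]

theorem MemH1.memLp_weakDeriv {f : E → ℂ} (hf : MemH1 f) (u : E) :
    MemLp (weakDeriv f u) 2 volume := by
  rw [weakDeriv, dif_pos (hf.2 u)]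
  exact (hf.2 u).choose_spec.1

theorem MemH1.isWeakDeriv {f : E → ℂ} (hf : MemH1 f) (u : E) :
    IsWeakDeriv f (weakDeriv f u) u := by
  rw [weakDeriv, dif_pos (hf.2 u)]
  exact (hf.2 u).choose_spec.2

end WeakDerivative

/-! ### Mollification and translation of weakly differentiable functions. -/

section Mollification

/-- The weak identity is tested on t ↦ η (x - t); the sign from the reflection cancels the sign from
integration by parts. -/
theorem IsWeakDeriv.fderiv_convolution {f g : R3 → ℂ} {u : R3} (h : IsWeakDeriv f g u)
    (hf : LocallyIntegrable f) {η : R3 → ℝ} (hη : ContDiff ℝ ∞ η) (hc : HasCompactSupport η)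
    (x : R3) :
    fderiv ℝ (η ⋆[lsmul ℝ ℝ, volume] f) x u = (η ⋆[lsmul ℝ ℝ, volume] g) x := by
  have hη1 : ContDiff ℝ 1 η := hη.of_le (by exact_mod_cast le_top)
  have hd := hc.hasFDerivAt_convolution_left (lsmul ℝ ℝ) hη1 hf x
  rw [hd.fderiv]
  have hex : ConvolutionExistsAt (fderiv ℝ η) f x ((lsmul ℝ ℝ : ℝ →L[ℝ] ℂ →L[ℝ] ℂ).precompL R3)
      volume :=
    (hc.fderiv ℝ).convolutionExists_left _ (hη1.continuous_fderiv one_ne_zero) hf x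
  have e1 : ((fderiv ℝ η) ⋆[(lsmul ℝ ℝ : ℝ →L[ℝ] ℂ →L[ℝ] ℂ).precompL R3, volume] f) x u
      = ∫ t, (fderiv ℝ η t u) • f (x - t) := by
    rw [convolution_def, ContinuousLinearMap.integral_apply hex]
    rfl
  rw [e1, convolution_eq_swap]
  have e2 : ∫ t, (fderiv ℝ η t u) • f (x - t) = ∫ t, (fderiv ℝ η (x - t) u) • f t := by
    rw [← integral_sub_left_eq_self _ _ x]
    simp
  have hz : ContDiff ℝ ∞ fun t => η (x - t) := hη.comp (contDiff_const.sub contDiff_id)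
  have hzc : HasCompactSupport fun t => η (x - t) :=
    hc.comp_homeomorph (Homeomorph.subLeft x)
  have e3 := h _ hz hzc
  have e4 : ∀ t, fderiv ℝ (fun t => η (x - t)) t u = - fderiv ℝ η (x - t) u := by
    intro t
    have h1 : HasFDerivAt (fun t : R3 => x - t) (-(ContinuousLinearMap.id ℝ R3)) t :=
      (hasFDerivAt_id t).const_sub x
    have h2 := ((hη1.differentiable one_ne_zero) (x - t)).hasFDerivAt.comp t h1
    have h3 : HasFDerivAt (fun t => η (x - t)) _ t := h2
    rw [h3.fderiv]
    simp
  simp only [e4, neg_smul, integral_neg, neg_inj] at e3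
  rw [e2, e3]
  rfl

theorem enorm_convolution_le {η : R3 → ℝ} {f : R3 → ℂ}
    (hη : AEStronglyMeasurable η) (hf : AEStronglyMeasurable f) (x : R3) :
    ‖(η ⋆[lsmul ℝ ℝ, volume] f) x‖ₑ ≤ eLpNorm η 2 volume * eLpNorm f 2 volume := by
  have hm := Measure.measurePreserving_sub_left (volume : Measure R3) x
  have := enorm_integral_smul_le (f := fun t => f (x - t)) hη (hf.comp_measurePreserving hm)
  rwa [show (fun t => f (x - t)) = f ∘ (fun t => x - t) from rfl,
    eLpNorm_comp_measurePreserving hf hm] at this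

/-- Testing a difference of translates against a test function. -/
theorem IsWeakDeriv.enorm_integral_translate_sub_le {f g : R3 → ℂ} {h : R3}
    (hw : IsWeakDeriv f g h) (hf : MemLp f 2 volume) (hg : MemLp g 2 volume)
    {η : R3 → ℝ} (hη : ContDiff ℝ ∞ η) (hc : HasCompactSupport η) :
    ‖∫ x, η x • (f (x - h) - f x)‖ₑ ≤ eLpNorm η 2 volume * eLpNorm g 2 volume := by
  -- Reflecting η turns the pairing of η with a translate of f into a value of the smooth function ζ
  -- ⋆ f.
  set ζ : R3 → ℝ := fun x => η (-x) with hζd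
  have hζ : ContDiff ℝ ∞ ζ := hη.comp contDiff_neg
  have hζc : HasCompactSupport ζ := hc.comp_homeomorph (Homeomorph.neg R3)
  have hζn : eLpNorm ζ 2 volume = eLpNorm η 2 volume :=
    eLpNorm_comp_measurePreserving hη.continuous.aestronglyMeasurable
      (Measure.measurePreserving_neg (volume : Measure R3))
  set G : R3 → ℂ := ζ ⋆[lsmul ℝ ℝ, volume] f with hG
  have hfl := hf.locallyIntegrable_two
  have hGd : ContDiff ℝ ∞ G := hζc.contDiff_convolution_left (lsmul ℝ ℝ) hζ hfl
  have hval : ∀ y, G y = ∫ x, η x • f (x + y) := by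
    intro y
    rw [hG, convolution_def, ← integral_neg_eq_self]
    simp [hζd, add_comm]
  have hint : ∀ y : R3, Integrable fun x => η x • f (x + y) := fun y =>
    integrable_test_smul
      (hf.comp_measurePreserving (measurePreserving_add_right volume y)).locallyIntegrable_two hη hc
  have e1 : ∫ x, η x • (f (x - h) - f x) = G (-h) - G 0 := by
    rw [hval, hval, ← integral_sub (hint _) (hint _)]
    simp [sub_eq_add_neg]
  set C := (eLpNorm η 2 volume * eLpNorm g 2 volume).toReal with hC
  have hηL : MemLp η 2 volume := hη.continuous.memLp_of_hasCompactSupport hc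
  have hfin : eLpNorm η 2 volume * eLpNorm g 2 volume ≠ ⊤ :=
    ENNReal.mul_ne_top hηL.eLpNorm_ne_top hg.eLpNorm_ne_top
  have hder : ∀ t : ℝ, HasDerivAt (fun t : ℝ => G (-(t • h)))
      (-(ζ ⋆[lsmul ℝ ℝ, volume] g) (-(t • h))) t := by
    intro t
    have h1 : HasDerivAt (fun t : ℝ => -(t • h)) (-h) t := by
      simpa using ((hasDerivAt_id t).smul_const h).fun_neg
    have h2 := ((hGd.differentiable (by simp)) (-(t • h))).hasFDerivAt.comp_hasDerivAt t h1
    rw [map_neg, hw.fderiv_convolution hfl hζ hζc] at h2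
    exact h2
  -- Mean value inequality along the segment from 0 to -h; the derivative is a value of ζ ⋆ g up to
  -- sign, bounded by Cauchy–Schwarz.
  have hb := norm_image_sub_le_of_norm_deriv_le_segment_01' (C := C)
    (fun t _ => (hder t).hasDerivWithinAt) (fun t _ => by
      rw [norm_neg, hC, ← toReal_enorm, ← hζn]
      exact ENNReal.toReal_mono (by rwa [hζn])
        (enorm_convolution_le hζ.continuous.aestronglyMeasurable hg.1 _))
  simp only [one_smul, zero_smul, neg_zero] at hb
  rw [e1, ← ofReal_norm]
  exact ENNReal.ofReal_le_of_le_toReal hb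

end Mollification

/-! ### L² bounds for averages of translates. -/

theorem eLpNorm_two_sq {α F : Type*} [MeasurableSpace α] [NormedAddCommGroup F] (μ : Measure α)
    (f : α → F) : eLpNorm f 2 μ ^ 2 = ∫⁻ x, ‖f x‖ₑ ^ 2 ∂μ := by
  have h := eLpNorm_nnreal_pow_eq_lintegral (f := f) (μ := μ) (p := 2) (by norm_num)
  norm_cast at h ⊢
  simpa using h

/-- On a probability space the L¹ norm is at most the L² norm; Tonelli then exchanges the integrals.
-/
theorem lintegral_enorm_integral_sq_le {ν : Measure R3} [IsProbabilityMeasure ν]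
    {F : R3 → R3 → ℂ} (hF : StronglyMeasurable (Function.uncurry F)) :
    ∫⁻ x, ‖∫ h, F x h ∂ν‖ₑ ^ 2 ≤ ∫⁻ h, (∫⁻ x, ‖F x h‖ₑ ^ 2) ∂ν := by
  rw [← lintegral_lintegral_swap (by fun_prop)]
  refine lintegral_mono fun x => ?_
  rw [← eLpNorm_two_sq]
  gcongr
  refine (enorm_integral_le_lintegral_enorm _).trans ?_
  rw [← eLpNorm_one_eq_lintegral_enorm]
  refine eLpNorm_le_eLpNorm_of_exponent_le (by norm_num) ?_
  exact (hF.comp_measurable measurable_prodMk_left).aestronglyMeasurable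

/-- The probability measure whose density is a normalized bump function. -/
noncomputable def bumpMeasure (φ : ContDiffBump (0 : R3)) : Measure R3 :=
  volume.withDensity fun t => ENNReal.ofReal (φ.normed volume t)

theorem isProbabilityMeasure_bumpMeasure (φ : ContDiffBump (0 : R3)) :
    IsProbabilityMeasure (bumpMeasure φ) := by
  constructor
  rw [bumpMeasure, withDensity_apply _ MeasurableSet.univ, Measure.restrict_univ,
    ← ofReal_integral_eq_lintegral_ofReal φ.integrable_normed
      (ae_of_all _ fun x => φ.nonneg_normed x), φ.integral_normed, ENNReal.ofReal_one]

theorem convolution_normed_eq (φ : ContDiffBump (0 : R3)) (f : R3 → ℂ) (x : R3) :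
    (φ.normed volume ⋆[lsmul ℝ ℝ, volume] f) x = ∫ t, f (x - t) ∂(bumpMeasure φ) := by
  rw [bumpMeasure, integral_withDensity_eq_integral_toReal_smul
    (φ.continuous_normed.measurable.ennreal_ofReal) (by simp), convolution_def]
  simp [ENNReal.toReal_ofReal (φ.nonneg_normed _)]

theorem convolution_congr_right {η : R3 → ℝ} {f f' : R3 → ℂ} (h : f =ᵐ[volume] f') (x : R3) :
    (η ⋆[lsmul ℝ ℝ, volume] f) x = (η ⋆[lsmul ℝ ℝ, volume] f') x := by
  rw [convolution_eq_swap, convolution_eq_swap]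
  exact integral_congr_ae (by filter_upwards [h] with t ht; rw [ht])

/-- The mollification averages translates of f, all of the same norm. A strongly measurable
representative is used so that Tonelli applies. -/
theorem eLpNorm_convolution_normed_le (φ : ContDiffBump (0 : R3)) {f : R3 → ℂ}
    (hf : AEStronglyMeasurable f) :
    eLpNorm (φ.normed volume ⋆[lsmul ℝ ℝ, volume] f) 2 volume ≤ eLpNorm f 2 volume := by
  have := isProbabilityMeasure_bumpMeasure φ
  have hs := hf.stronglyMeasurable_mk
  rw [← ENNReal.pow_le_pow_left_iff two_ne_zero, eLpNorm_congr_ae hf.ae_eq_mk]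
  rw [eLpNorm_two_sq]
  simp only [convolution_congr_right hf.ae_eq_mk, convolution_normed_eq]
  refine (lintegral_enorm_integral_sq_le (F := fun x t => hf.mk f (x - t))
    (hs.comp_measurable measurable_sub)).trans ?_
  have : ∀ t : R3, ∫⁻ x, ‖hf.mk f (x - t)‖ₑ ^ 2 = eLpNorm (hf.mk f) 2 volume ^ 2 := by
    intro t
    rw [eLpNorm_two_sq]
    exact lintegral_sub_right_eq_self (fun x => ‖hf.mk f x‖ₑ ^ 2) t
  simp [this]

/-- The error is the average of f (x - t) - f x over t in the support of the bump, which is the ball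
of radius `φ.rOut`. -/
theorem eLpNorm_convolution_normed_sub_le (φ : ContDiffBump (0 : R3)) {f : R3 → ℂ}
    (hf : MemLp f 2 volume) {C : ℝ≥0∞}
    (hC : ∀ t, ‖t‖ < φ.rOut → eLpNorm (fun x => f (x - t) - f x) 2 volume ≤ C) :
    eLpNorm (φ.normed volume ⋆[lsmul ℝ ℝ, volume] f - f) 2 volume ≤ C := by
  have := isProbabilityMeasure_bumpMeasure φ
  set f' := hf.1.mk f with hf'
  have hs : StronglyMeasurable f' := hf.1.stronglyMeasurable_mk
  have he : f =ᵐ[volume] f' := hf.1.ae_eq_mk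
  have hl : LocallyIntegrable f' := (hf.ae_eq he).locallyIntegrable_two
  have e1 : eLpNorm (φ.normed volume ⋆[lsmul ℝ ℝ, volume] f - f) 2 volume
      = eLpNorm (fun x => ∫ t, (f' (x - t) - f' x) ∂(bumpMeasure φ)) 2 volume := by
    refine eLpNorm_congr_ae ?_
    filter_upwards [he] with x hx
    rw [Pi.sub_apply, hx, convolution_congr_right he, convolution_normed_eq, integral_sub]
    · simp
    · have hex : ConvolutionExistsAt (φ.normed volume) f' x (lsmul ℝ ℝ : ℝ →L[ℝ] ℂ →L[ℝ] ℂ)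
          volume :=
        φ.hasCompactSupport_normed.convolutionExists_left _ φ.continuous_normed hl x
      rw [bumpMeasure, integrable_withDensity_iff_integrable_smul'
        (φ.continuous_normed.measurable.ennreal_ofReal) (by simp)]
      simpa [ConvolutionExistsAt, ENNReal.toReal_ofReal (φ.nonneg_normed _)] using hex
    · exact integrable_const _
  rw [e1, ← ENNReal.pow_le_pow_left_iff two_ne_zero, eLpNorm_two_sq]
  refine (lintegral_enorm_integral_sq_le (F := fun x t => f' (x - t) - f' x)
    ((hs.comp_measurable measurable_sub).sub (hs.comp_measurable measurable_fst))).trans ?_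
  calc ∫⁻ t, (∫⁻ x, ‖f' (x - t) - f' x‖ₑ ^ 2) ∂(bumpMeasure φ)
      ≤ ∫⁻ _, C ^ 2 ∂(bumpMeasure φ) := by
        refine lintegral_mono_ae ?_
        rw [bumpMeasure, ae_withDensity_iff (φ.continuous_normed.measurable.ennreal_ofReal)]
        refine ae_of_all _ fun t ht => ?_
        have htm : t ∈ Function.support (φ.normed volume) := by
          intro h0; simp [h0] at ht
        rw [φ.support_normed_eq] at htm
        rw [← eLpNorm_two_sq (f := fun x => f' (x - t) - f' x)]
        gcongr
        refine le_trans (le_of_eq (eLpNorm_congr_ae ?_)) (hC t (by simpa using htm))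
        filter_upwards [he, (measurePreserving_sub_right volume t).quasiMeasurePreserving.ae_eq_comp
          he] with x hx hx'
        simp only [Function.comp] at hx'
        rw [hx, hx']
    _ = C ^ 2 := by simp

/-- By duality: the translation difference is paired with smooth test functions, which are dense in
L², and finally with itself. The factor 2 comes from splitting complex test functions into real and
imaginary parts. -/
theorem IsWeakDeriv.eLpNorm_translate_sub_le {f g : R3 → ℂ} {h : R3}
    (hw : IsWeakDeriv f g h) (hf : MemLp f 2 volume) (hg : MemLp g 2 volume) :
    eLpNorm (fun x => f (x - h) - f x) 2 volume ≤ 2 * eLpNorm g 2 volume := by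
  have hD : MemLp (fun x => f (x - h) - f x) 2 volume :=
    (hf.comp_measurePreserving (measurePreserving_sub_right volume h)).sub hf
  set D := fun x => f (x - h) - f x with hDd
  set d : Lp ℂ 2 (volume : Measure R3) := hD.toLp D
  set C := (eLpNorm g 2 volume).toReal with hC
  have key : ∀ w : Lp ℂ 2 (volume : Measure R3), ‖inner ℂ w d‖ ≤ 2 * C * ‖w‖ := by
    have hcl : IsClosed {w : Lp ℂ 2 (volume : Measure R3) | ‖inner ℂ w d‖ ≤ 2 * C * ‖w‖} :=
      isClosed_le (by fun_prop) (by fun_prop)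
    have hdense := Lp.dense_hasCompactSupport_contDiff (F := ℂ) (μ := (volume : Measure R3))
      (p := 2) (by norm_num)
    intro w
    refine hcl.closure_subset_iff.2 ?_ (hdense w)
    rintro w ⟨η, hwη, hc, hη⟩
    have hηL : MemLp η 2 volume := hη.continuous.memLp_of_hasCompactSupport hc
    have hwn : ‖w‖ = (eLpNorm η 2 volume).toReal := by
      rw [Lp.norm_def, eLpNorm_congr_ae hwη]
    have hre : ContDiff ℝ ∞ fun x => (η x).re := Complex.reCLM.contDiff.comp hη
    have him : ContDiff ℝ ∞ fun x => (η x).im := Complex.imCLM.contDiff.comp hη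
    have hrec : HasCompactSupport fun x => (η x).re := hc.comp_left (g := Complex.re) rfl
    have himc : HasCompactSupport fun x => (η x).im := hc.comp_left (g := Complex.im) rfl
    have hDl := hD.locallyIntegrable_two
    have e1 : inner ℂ w d = (∫ x, (η x).re • D x) - Complex.I * ∫ x, (η x).im • D x := by
      rw [L2.inner_def, ← integral_const_mul, ← integral_sub (integrable_test_smul hDl hre hrec)
        ((integrable_test_smul hDl him himc).const_mul _)]
      refine integral_congr_ae ?_
      filter_upwards [hwη, hD.coeFn_toLp] with x hx hx'
      rw [hx, hx']
      apply Complex.ext <;> simp [Complex.mul_re, Complex.mul_im] <;> ring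
    have bound : ∀ ζ : R3 → ℝ, ContDiff ℝ ∞ ζ → HasCompactSupport ζ → (∀ x, ‖ζ x‖ ≤ ‖η x‖) →
        ‖∫ x, ζ x • D x‖ ≤ ‖w‖ * C := by
      intro ζ hζ hζc hle
      have h1 := hw.enorm_integral_translate_sub_le hf hg hζ hζc
      have h2 : ‖∫ x, ζ x • D x‖ₑ ≤ eLpNorm η 2 volume * eLpNorm g 2 volume :=
        h1.trans (by gcongr; exact eLpNorm_mono hle)
      rw [hwn, hC, ← ENNReal.toReal_mul, ← toReal_enorm]
      exact ENNReal.toReal_mono (ENNReal.mul_ne_top hηL.eLpNorm_ne_top hg.eLpNorm_ne_top) h2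
    have b1 := bound _ hre hrec fun x => Complex.abs_re_le_norm _
    have b2 := bound _ him himc fun x => Complex.abs_im_le_norm _
    simp only [Set.mem_ofPred_eq]
    rw [e1]
    refine (norm_sub_le _ _).trans ?_
    rw [norm_mul, Complex.norm_I, one_mul]
    linarith
  have hdn : ‖d‖ ≤ 2 * C := by
    have h1 := key d
    rw [inner_self_eq_norm_sq_to_K] at h1
    norm_num at h1
    by_contra hlt
    push Not at hlt
    have : 0 ≤ C := ENNReal.toReal_nonneg
    nlinarith
  have hdn' : ‖d‖ = (eLpNorm D 2 volume).toReal := Lp.norm_toLp _ _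
  rw [hdn'] at hdn
  rw [← ENNReal.toReal_le_toReal hD.eLpNorm_ne_top
    (ENNReal.mul_ne_top (by norm_num) hg.eLpNorm_ne_top), ENNReal.toReal_mul]
  simpa using hdn

/-! ### Weak sequential compactness and lower semicontinuity in L². -/

/-- Weak convergence of a sequence in `L²(ℝ³)`. -/
def L2WeakTendsto (f : ℕ → R3 → ℂ) (g : R3 → ℂ) : Prop :=
  ∀ h : R3 → ℂ, MemLp h 2 volume →
    Tendsto (fun n => ∫ x, h x * f n x) atTop (𝓝 (∫ x, h x * g x))

theorem L2WeakTendsto.comp {f : ℕ → R3 → ℂ} {g : R3 → ℂ} (h : L2WeakTendsto f g) {s : ℕ → ℕ}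
    (hs : StrictMono s) : L2WeakTendsto (fun n => f (s n)) g :=
  fun w hw => (h w hw).comp hs.tendsto_atTop

/-- Sequential Banach–Alaoglu in the dual of a separable space, carried to H by the Riesz map. -/
theorem exists_subseq_tendsto_inner {H : Type*} [NormedAddCommGroup H] [InnerProductSpace ℂ H]
    [CompleteSpace H] [TopologicalSpace.SeparableSpace H] {u : ℕ → H} {C : ℝ}
    (hu : ∀ n, ‖u n‖ ≤ C) :
    ∃ v : H, ∃ s : ℕ → ℕ, StrictMono s ∧
      ∀ w, Tendsto (fun n => inner ℂ w (u (s n))) atTop (𝓝 (inner ℂ w v)) := by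
  have hcomp := WeakDual.isSeqCompact_closedBall ℂ H 0 C
  obtain ⟨a, -, s, hs, hlim⟩ := hcomp
    (x := fun n => StrongDual.toWeakDual (InnerProductSpace.toDual ℂ H (u n))) (fun n => by
    simp only [Set.mem_preimage, Metric.mem_closedBall, dist_zero_right]
    exact ((InnerProductSpace.toDual ℂ _).norm_map (u n)).le.trans (hu n))
  refine ⟨(InnerProductSpace.toDual ℂ H).symm (WeakDual.toStrongDual a), s, hs, fun w => ?_⟩
  have h1 : Tendsto (fun n => inner ℂ (u (s n)) w) atTop (𝓝 (a w)) :=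
    ((WeakDual.eval_continuous w).tendsto a).comp hlim
  have h2 : a w = inner ℂ ((InnerProductSpace.toDual ℂ H).symm (WeakDual.toStrongDual a)) w := by
    rw [InnerProductSpace.toDual_symm_apply]
    rfl
  rw [h2] at h1
  simpa only [Function.comp_def, inner_conj_symm] using (Complex.continuous_conj.tendsto _).comp h1

theorem exists_subseq_L2WeakTendsto {f : ℕ → R3 → ℂ} (hf : ∀ n, MemLp (f n) 2 volume) {C : ℝ≥0∞}
    (hC : C ≠ ⊤) (hb : ∀ n, eLpNorm (f n) 2 volume ≤ C) :
    ∃ g, MemLp g 2 volume ∧ ∃ s : ℕ → ℕ, StrictMono s ∧ L2WeakTendsto (fun n => f (s n)) g := by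
  have : Fact ((2 : ℝ≥0∞) ≠ ⊤) := ⟨by norm_num⟩
  obtain ⟨v, s, hs, hlim⟩ := exists_subseq_tendsto_inner
    (H := Lp ℂ 2 (volume : Measure R3)) (u := fun n => (hf n).toLp (f n)) (C := C.toReal)
    (fun n => by rw [Lp.norm_toLp]; exact ENNReal.toReal_mono hC (hb n))
  refine ⟨v, Lp.memLp v, s, hs, fun h hh => ?_⟩
  -- `L2WeakTendsto` pairs without conjugation, so the Hilbert space test vector is the conjugate of
  -- h.
  have hst : MemLp (fun x => (starRingEnd ℂ) (h x)) 2 volume := hh.star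
  have h5 : ∀ z : Lp ℂ 2 (volume : Measure R3), inner ℂ (hst.toLp _) z = ∫ x, h x * z x := by
    intro z
    rw [L2.inner_def]
    refine integral_congr_ae ?_
    filter_upwards [hst.coeFn_toLp] with x hx
    rw [hx]
    simp [mul_comm]
  have h4 := hlim (hst.toLp _)
  simp only [h5] at h4
  refine h4.congr fun n => ?_
  refine integral_congr_ae ?_
  filter_upwards [(hf (s n)).coeFn_toLp] with x hx
  rw [hx]

/-- Both sides of the defining identity are pairings with fixed L² functions, so they pass to the
weak limit. -/
theorem IsWeakDeriv.of_L2WeakTendsto {f g : ℕ → R3 → ℂ} {f' g' : R3 → ℂ} {u : R3}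
    (h : ∀ n, IsWeakDeriv (f n) (g n) u) (hf : L2WeakTendsto f f') (hg : L2WeakTendsto g g') :
    IsWeakDeriv f' g' u := by
  intro η hη hc
  have hm : ∀ ζ : R3 → ℝ, Continuous ζ → HasCompactSupport ζ →
      MemLp (fun x => (ζ x : ℂ)) 2 volume := fun ζ hζ hζc =>
    (Complex.continuous_ofReal.comp hζ).memLp_of_hasCompactSupport
      (hζc.comp_left (g := Complex.ofReal) rfl)
  have h1 := hf _ (hm _ ((hη.continuous_fderiv (by simp)).clm_apply continuous_const)
    (hc.fderiv_apply (𝕜 := ℝ) u))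
  have h2 := (hg _ (hm _ hη.continuous hc)).neg
  have h3 : ∀ n, ∫ x, ((fderiv ℝ η x u : ℝ) : ℂ) * f n x = - ∫ x, (η x : ℂ) * g n x := fun n => by
    simpa only [Complex.real_smul] using h n η hη hc
  simp only [h3] at h1
  simpa only [Complex.real_smul] using tendsto_nhds_unique h1 h2

theorem _root_.MeasureTheory.MemLp.integrable_norm_sq {f : R3 → ℂ} (hf : MemLp f 2 volume) :
    Integrable fun x => ‖f x‖ ^ 2 := by
  simpa using hf.integrable_norm_rpow (by norm_num) (by norm_num)

theorem integrable_mul_of_memLp_two {f h : R3 → ℂ} (hf : MemLp f 2 volume)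
    (hh : MemLp h 2 volume) : Integrable fun x => h x * f x :=
  hh.integrable_mul hf

/-- Weak lower semicontinuity of the square of the `L²` norm. -/
theorem L2WeakTendsto.eventually_integral_sq_le {f : ℕ → R3 → ℂ} {g : R3 → ℂ}
    (h : L2WeakTendsto f g) (hf : ∀ n, MemLp (f n) 2 volume) (hg : MemLp g 2 volume)
    {ε : ℝ} (hε : 0 < ε) : ∀ᶠ n in atTop, (∫ x, ‖g x‖ ^ 2) - ε ≤ ∫ x, ‖f n x‖ ^ 2 := by
  have hst : MemLp (fun x => (starRingEnd ℂ) (g x)) 2 volume := hg.star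
  have h1 := (Complex.continuous_re.tendsto _).comp (h _ hst)
  have hre : ∀ f' : R3 → ℂ, MemLp f' 2 volume →
      (∫ x, (starRingEnd ℂ) (g x) * f' x).re = ∫ x, ((starRingEnd ℂ) (g x) * f' x).re :=
    fun f' hf' => (integral_re (𝕜 := ℂ) (integrable_mul_of_memLp_two hf' hst)).symm
  have h2 : ∫ x, ((starRingEnd ℂ) (g x) * g x).re = ∫ x, ‖g x‖ ^ 2 := by
    refine integral_congr_ae (ae_of_all _ fun x => ?_)
    simp only [mul_comm, Complex.mul_conj, Complex.ofReal_re, Complex.normSq_eq_norm_sq]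
  rw [hre g hg, h2] at h1
  have h3 := h1.eventually (lt_mem_nhds (show (∫ x, ‖g x‖ ^ 2) - ε / 2 < ∫ x, ‖g x‖ ^ 2 by linarith))
  filter_upwards [h3] with n hn
  simp only [Function.comp_apply, hre (f n) (hf n)] at hn
  -- Expanding the square gives ‖f n‖² ≥ 2 Re⟨g, f n⟩ - ‖g‖², and the cross term exceeds ‖g‖² - ε/2.
  have h4 : 0 ≤ ∫ x, ‖f n x - g x‖ ^ 2 := integral_nonneg fun x => by positivity
  have h5 : ∫ x, ‖f n x - g x‖ ^ 2 = (∫ x, ‖f n x‖ ^ 2)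
      - 2 * (∫ x, ((starRingEnd ℂ) (g x) * f n x).re) + ∫ x, ‖g x‖ ^ 2 := by
    have i1 := (hf n).integrable_norm_sq
    have i2 := hg.integrable_norm_sq
    have i3 : Integrable fun x => ((starRingEnd ℂ) (g x) * f n x).re :=
      (integrable_mul_of_memLp_two (hf n) hst).re
    rw [← integral_const_mul, ← integral_sub i1 (i3.const_mul 2),
      ← integral_add (by exact i1.sub (i3.const_mul 2)) i2]
    refine integral_congr_ae (ae_of_all _ fun x => ?_)
    simp only [← Complex.normSq_eq_norm_sq, Complex.normSq_apply, Complex.sub_re, Complex.sub_im,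
      Complex.mul_re, Complex.conj_re, Complex.conj_im]
    ring
  linarith

/-! ### Rellich-type compactness. -/

/-- The bound linear in ‖u‖ serves as a modulus of continuity for translations by u. -/
theorem exists_isWeakDeriv_of_coordDir {f : R3 → ℂ} {g : Fin 3 → R3 → ℂ} (hf : MemLp f 2 volume)
    (hg : ∀ k, MemLp (g k) 2 volume) (h : ∀ k, IsWeakDeriv f (g k) (coordDir k)) (u : R3) :
    ∃ G, MemLp G 2 volume ∧ IsWeakDeriv f G u ∧
      eLpNorm G 2 volume ≤ ‖u‖ₑ * ∑ k, eLpNorm (g k) 2 volume := by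
  refine ⟨fun x => ∑ k, u k • g k x, ?_, ?_, ?_⟩
  · exact memLp_finsetSum _ fun k _ => (hg k).const_smul (u k)
  · have := IsWeakDeriv.sum_smul Finset.univ (fun k => u k) hf hg h
    convert this using 1
    ext j
    simp [coordDir, Finset.sum_apply, Pi.single_apply]
  · have h1 := eLpNorm_sum_le (μ := (volume : Measure R3)) (p := 2) (s := Finset.univ)
      (f := fun (k : Fin 3) => u k • g k)
      (fun k _ => (hg k).1.const_smul (u k)) (by norm_num)
    have h2 : (∑ k, u k • g k) = fun x => ∑ k, u k • g k x := by
      ext x; simp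
    rw [h2] at h1
    refine h1.trans ?_
    rw [Finset.mul_sum]
    refine Finset.sum_le_sum fun k _ => ?_
    rw [eLpNorm_const_smul]
    gcongr
    rw [enorm_le_iff_norm_le]
    exact PiLp.norm_apply_le u k

/-- A weakly null sequence in `L²` with bounded weak derivatives and uniformly small tails tends
to `0` in norm. -/
theorem tendsto_eLpNorm_of_L2WeakTendsto_zero {D : ℕ → R3 → ℂ} (hD : ∀ n, MemLp (D n) 2 volume)
    {M C : ℝ≥0∞} (hM : M ≠ ⊤) (hC : C ≠ ⊤) (hDM : ∀ n, eLpNorm (D n) 2 volume ≤ M)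
    (hder : ∀ n u, ∃ G, MemLp G 2 volume ∧ IsWeakDeriv (D n) G u ∧
      eLpNorm G 2 volume ≤ ‖u‖ₑ * C)
    (htight : ∀ ε : ℝ≥0∞, 0 < ε → ∃ R : ℝ, ∀ n,
      eLpNorm ((Metric.ball (0 : R3) R)ᶜ.indicator (D n)) 2 volume ≤ ε)
    (hw : L2WeakTendsto D 0) :
    Tendsto (fun n => eLpNorm (D n) 2 volume) atTop (𝓝 0) := by
  rw [ENNReal.tendsto_nhds_zero]
  intro ε hε
  have hε3 : 0 < ε / 3 := ENNReal.div_pos hε.ne' (by norm_num)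
  obtain ⟨R, hR⟩ := htight _ hε3
  -- r is the mollification radius: translations shorter than r move D n by at most 2rC in L².
  obtain ⟨r, hr, hrC⟩ : ∃ r : ℝ, 0 < r ∧ 2 * (ENNReal.ofReal r * C) ≤ ε / 3 := by
    have h1 : Tendsto (fun r : ℝ => 2 * (ENNReal.ofReal r * C)) (𝓝[>] 0) (𝓝 0) := by
      have h2 : Tendsto (fun r : ℝ => 2 * (ENNReal.ofReal r * C)) (𝓝 0)
          (𝓝 (2 * (ENNReal.ofReal 0 * C))) := by
        refine ENNReal.Tendsto.const_mul ?_ (Or.inr (by norm_num))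
        exact ENNReal.Tendsto.mul_const (ENNReal.continuous_ofReal.tendsto _) (Or.inr hC)
      simp only [ENNReal.ofReal_zero, zero_mul, mul_zero] at h2
      exact h2.mono_left nhdsWithin_le_nhds
    obtain ⟨r, h3, h4⟩ := (((ENNReal.tendsto_nhds_zero.1 h1) _ hε3).and
      self_mem_nhdsWithin).exists
    exact ⟨r, h4, h3⟩
  let φ : ContDiffBump (0 : R3) := ⟨r / 2, r, by positivity, by linarith⟩
  set η := φ.normed (volume : Measure R3) with hη
  have hηc : Continuous η := φ.continuous_normed
  have hηs : HasCompactSupport η := φ.hasCompactSupport_normed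
  have hηL : MemLp η 2 volume := hηc.memLp_of_hasCompactSupport hηs
  set B := Metric.ball (0 : R3) R with hB
  have hBm : MeasurableSet B := measurableSet_ball
  have hcm : ∀ n, Continuous (η ⋆[lsmul ℝ ℝ, volume] (D n)) := fun n =>
    hηs.continuous_convolution_left _ hηc (hD n).locallyIntegrable_two
  -- At fixed x the convolution is the pairing of D n with a fixed L² function, so weak convergence
  -- becomes pointwise convergence.
  have hpt : ∀ x, Tendsto (fun n => (η ⋆[lsmul ℝ ℝ, volume] (D n)) x) atTop (𝓝 0) := by
    intro x
    have hm : MemLp (fun t => ((η (x - t) : ℝ) : ℂ)) 2 volume :=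
      (Complex.continuous_ofReal.comp (hηc.comp (continuous_const.sub continuous_id))
        ).memLp_of_hasCompactSupport
        ((hηs.comp_homeomorph (Homeomorph.subLeft x)).comp_left (g := Complex.ofReal) rfl)
    have := hw _ hm
    simp only [Pi.zero_apply, mul_zero, integral_zero] at this
    refine this.congr fun n => ?_
    rw [convolution_eq_swap]
    simp
  have hloc : Tendsto (fun n => eLpNorm (B.indicator (η ⋆[lsmul ℝ ℝ, volume] (D n))) 2 volume)
      atTop (𝓝 0) := by
    have h1 : Tendsto (fun n => ∫⁻ x in B, ‖(η ⋆[lsmul ℝ ℝ, volume] (D n)) x‖ₑ ^ 2) atTop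
        (𝓝 (∫⁻ x in B, 0)) := by
      refine tendsto_lintegral_of_dominated_convergence
        (fun _ => (eLpNorm η 2 volume * M) ^ 2) (fun n => by fun_prop)
        (fun n => ae_of_all _ fun x => ?_) ?_ (ae_of_all _ fun x => ?_)
      · exact pow_le_pow_left' ((enorm_convolution_le hηc.aestronglyMeasurable (hD n).1 x).trans
          (by gcongr; exact hDM n)) 2
      · rw [setLIntegral_const]
        exact ENNReal.mul_ne_top (ENNReal.pow_ne_top (ENNReal.mul_ne_top hηL.eLpNorm_ne_top hM))
          measure_ball_lt_top.ne
      · have := ((ENNReal.continuous_pow 2).comp continuous_enorm).tendsto _ |>.comp (hpt x)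
        simpa [Function.comp_def] using this
    have h2 : ∀ n, eLpNorm (B.indicator (η ⋆[lsmul ℝ ℝ, volume] (D n))) 2 volume
        = (∫⁻ x in B, ‖(η ⋆[lsmul ℝ ℝ, volume] (D n)) x‖ₑ ^ 2) ^ (2⁻¹ : ℝ) := by
      intro n
      rw [eLpNorm_indicator_eq_eLpNorm_restrict hBm, ← eLpNorm_two_sq, ← ENNReal.rpow_natCast,
        ← ENNReal.rpow_mul]
      norm_num
    simp only [h2]
    have h3 := (ENNReal.continuous_rpow_const (y := (2⁻¹ : ℝ))).tendsto 0 |>.comp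
      (by simpa using h1)
    simpa [Function.comp_def] using h3
  filter_upwards [(ENNReal.tendsto_nhds_zero.1 hloc) _ hε3] with n hn
  set c := η ⋆[lsmul ℝ ℝ, volume] (D n) with hc
  -- Tail, mollification error, and mollified part on the ball: each contributes at most ε/3.
  have hsplit : D n = Bᶜ.indicator (D n) - B.indicator (c - D n) + B.indicator c := by
    ext x
    by_cases hx : x ∈ B <;> simp [hx]
  have hdiff : eLpNorm (c - D n) 2 volume ≤ ε / 3 := by
    refine eLpNorm_convolution_normed_sub_le φ (hD n) fun t ht => ?_
    obtain ⟨G, hG, hwd, hle⟩ := hder n t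
    refine (hwd.eLpNorm_translate_sub_le (hD n) hG).trans (le_trans ?_ hrC)
    have : ‖t‖ₑ ≤ ENNReal.ofReal r := by
      rw [← ofReal_norm]; exact ENNReal.ofReal_le_ofReal ht.le
    exact mul_le_mul_right (hle.trans (mul_le_mul_left this C)) 2
  have hcD : AEStronglyMeasurable (c - D n) := (hcm n).aestronglyMeasurable.sub (hD n).1
  calc eLpNorm (D n) 2 volume
      = eLpNorm (Bᶜ.indicator (D n) - B.indicator (c - D n) + B.indicator c) 2 volume := by
        rw [← hsplit]
    _ ≤ eLpNorm (Bᶜ.indicator (D n) - B.indicator (c - D n)) 2 volume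
        + eLpNorm (B.indicator c) 2 volume :=
        eLpNorm_add_le (((hD n).1.indicator hBm.compl).sub (hcD.indicator hBm))
          ((hcm n).aestronglyMeasurable.indicator hBm) (by norm_num)
    _ ≤ (eLpNorm (Bᶜ.indicator (D n)) 2 volume + eLpNorm (B.indicator (c - D n)) 2 volume)
        + eLpNorm (B.indicator c) 2 volume := by
        gcongr
        exact eLpNorm_sub_le ((hD n).1.indicator hBm.compl) (hcD.indicator hBm) (by norm_num)
    _ ≤ (ε / 3 + ε / 3) + ε / 3 := by
        gcongr
        · exact hR n
        · exact (eLpNorm_indicator_le _).trans hdiff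
    _ = ε := ENNReal.add_thirds ε

/-! ### Sobolev embedding. -/

theorem norm_le_sum_norm_coordDir (A : R3 →L[ℝ] ℂ) : ‖A‖ ≤ ∑ k, ‖A (coordDir k)‖ := by
  refine A.opNorm_le_bound (Finset.sum_nonneg fun _ _ => norm_nonneg _) fun v => ?_
  have hv : v = ∑ k, v k • coordDir k := by
    ext j
    simp [coordDir, Finset.sum_apply, Pi.single_apply]
  calc ‖A v‖ = ‖∑ k, v k • A (coordDir k)‖ := by
        conv_lhs => rw [hv]
        simp only [map_sum, map_smul]
    _ ≤ ∑ k, ‖v k • A (coordDir k)‖ := norm_sum_le _ _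
    _ ≤ ∑ k, ‖A (coordDir k)‖ * ‖v‖ := by
        refine Finset.sum_le_sum fun k _ => ?_
        rw [norm_smul, mul_comm]
        gcongr
        exact PiLp.norm_apply_le v k
    _ = _ := by rw [Finset.sum_mul]

theorem eLpNorm_six_le_of_smooth {u : R3 → ℂ} (hu : ContDiff ℝ 1 u) (hc : HasCompactSupport u) :
    eLpNorm u 6 volume ≤
      SNormLESNormFDerivOfEqConst ℂ (volume : Measure R3) 2 * eLpNorm (fderiv ℝ u) 2 volume := by
  have h := eLpNorm_le_eLpNorm_fderiv_of_eq (volume : Measure R3) hu hc (p := 2) (p' := 6)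
    (by norm_num) (by simp) (by simp; norm_num)
  simpa using h

/-- The Sobolev embedding `H¹(ℝ³) ⊆ L⁶(ℝ³)`. -/
theorem MemH1.memLp_six {f : R3 → ℂ} (hf : MemH1 f) : MemLp f 6 volume := by
  have hfl := hf.1.locallyIntegrable_two
  -- f is mollified at scale 1/(n+1) and cut off at scale n+1. The ratio 2 of outer to inner radius
  -- gives a.e. convergence of the mollifications.
  let φ : ℕ → ContDiffBump (0 : R3) := fun n =>
    ⟨1 / ((n : ℝ) + 1) / 2, 1 / ((n : ℝ) + 1), by positivity, half_lt_self (by positivity)⟩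
  let χ : ContDiffBump (0 : R3) := ⟨1, 2, by norm_num, by norm_num⟩
  set F : ℕ → R3 → ℂ := fun n => (φ n).normed volume ⋆[lsmul ℝ ℝ, volume] f with hF
  set X : ℕ → R3 → ℝ := fun n x => χ (((n : ℝ) + 1)⁻¹ • x) with hX
  have hη : ∀ n, ContDiff ℝ ∞ ((φ n).normed (volume : Measure R3)) := fun n => (φ n).contDiff_normed
  have hηc := fun n => (φ n).hasCompactSupport_normed (μ := (volume : Measure R3))
  have hFd : ∀ n, ContDiff ℝ ∞ (F n) := fun n =>
    (hηc n).contDiff_convolution_left (lsmul ℝ ℝ) (hη n) hfl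
  have hχd : ContDiff ℝ ∞ χ := χ.contDiff
  have hXd : ∀ n, ContDiff ℝ ∞ (X n) := fun n => hχd.comp (contDiff_const_smul _)
  have hXc : ∀ n, HasCompactSupport (X n) := fun n =>
    χ.hasCompactSupport.comp_homeomorph
      (Homeomorph.smulOfNeZero ((n : ℝ) + 1)⁻¹ (by positivity))
  obtain ⟨L, hL⟩ := (χ.hasCompactSupport.fderiv ℝ).exists_bound_of_continuous
    (hχd.continuous_fderiv (by simp))
  have hL0 : 0 ≤ L := (norm_nonneg _).trans (hL 0)
  -- Widening the cutoff only shrinks its gradient, so one constant serves all n.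
  have hXL : ∀ n x, ‖fderiv ℝ (X n) x‖ ≤ L := by
    intro n x
    have h1 : fderiv ℝ (X n) x = ((n : ℝ) + 1)⁻¹ • fderiv ℝ χ (((n : ℝ) + 1)⁻¹ • x) := by
      rw [hX]
      exact fderiv_comp_smul _
    rw [h1, norm_smul]
    have h2 : ‖((n : ℝ) + 1)⁻¹‖ ≤ 1 := by
      rw [norm_inv, Real.norm_of_nonneg (by positivity)]
      exact inv_le_one_of_one_le₀ (by linarith [n.cast_nonneg (α := ℝ)])
    calc _ ≤ 1 * L := mul_le_mul h2 (hL _) (norm_nonneg _) zero_le_one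
      _ = L := one_mul L
  set g : Fin 3 → R3 → ℂ := fun k => weakDeriv f (coordDir k) with hg
  have hgL : ∀ k, MemLp (g k) 2 volume := fun k => hf.memLp_weakDeriv _
  have hder : ∀ n x, ‖fderiv ℝ (fun x => X n x • F n x) x‖
      ≤ (∑ k, ‖((φ n).normed volume ⋆[lsmul ℝ ℝ, volume] g k) x‖) + L * ‖F n x‖ := by
    intro n x
    have hx1 := (hXd n).differentiable (by simp) x
    have hx2 := (hFd n).differentiable (by simp) x
    rw [fderiv_fun_smul hx1 hx2]
    refine (norm_add_le _ _).trans (add_le_add ?_ ?_)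
    · rw [norm_smul]
      have h1 : ‖X n x‖ ≤ 1 := by
        rw [Real.norm_of_nonneg χ.nonneg]; exact χ.le_one
      have h2 : ‖fderiv ℝ (F n) x‖ ≤ ∑ k, ‖((φ n).normed volume ⋆[lsmul ℝ ℝ, volume] g k) x‖ := by
        refine (norm_le_sum_norm_coordDir _).trans (le_of_eq (Finset.sum_congr rfl fun k _ => ?_))
        rw [(hf.isWeakDeriv (coordDir k)).fderiv_convolution hfl (hη n) (hηc n)]
      calc _ ≤ 1 * _ := mul_le_mul h1 h2 (norm_nonneg _) zero_le_one
        _ = _ := one_mul _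
    · rw [ContinuousLinearMap.norm_smulRight_apply]
      exact mul_le_mul_of_nonneg_right (hXL n x) (norm_nonneg _)
  have hgc : ∀ n k, Continuous ((φ n).normed volume ⋆[lsmul ℝ ℝ, volume] g k) := fun n k =>
    (hηc n).continuous_convolution_left _ (φ n).continuous_normed (hgL k).locallyIntegrable_two
  set C : ℝ≥0∞ := (∑ k, eLpNorm (g k) 2 volume) + ENNReal.ofReal L * eLpNorm f 2 volume with hC
  have hCtop : C ≠ ⊤ := ENNReal.add_ne_top.2
    ⟨ENNReal.sum_ne_top.2 fun k _ => (hgL k).eLpNorm_ne_top,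
      ENNReal.mul_ne_top ENNReal.ofReal_ne_top hf.1.eLpNorm_ne_top⟩
  have hderC : ∀ n, eLpNorm (fderiv ℝ (fun x => X n x • F n x)) 2 volume ≤ C := by
    intro n
    set a : Fin 3 → R3 → ℝ := fun k x => ‖((φ n).normed volume ⋆[lsmul ℝ ℝ, volume] g k) x‖ with ha
    have ham : ∀ k, AEStronglyMeasurable (a k) volume := fun k =>
      (hgc n k).norm.aestronglyMeasurable
    have hsm : AEStronglyMeasurable (∑ k, a k) volume :=
      Finset.aestronglyMeasurable_sum _ fun k _ => ham k
    have h1 : eLpNorm (fderiv ℝ (fun x => X n x • F n x)) 2 volume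
        ≤ eLpNorm ((∑ k, a k) + L • fun x => ‖F n x‖) 2 volume := by
      refine eLpNorm_mono_real fun x => ?_
      simpa [ha] using hder n x
    refine h1.trans ((eLpNorm_add_le hsm
      ((hFd n).continuous.norm.const_smul L).aestronglyMeasurable (by norm_num)).trans ?_)
    refine add_le_add ((eLpNorm_sum_le (fun k _ => ham k) (by norm_num)).trans
      (Finset.sum_le_sum fun k _ => ?_)) ?_
    · rw [ha]
      simp only [eLpNorm_norm]
      exact eLpNorm_convolution_normed_le _ (hgL k).1
    · rw [eLpNorm_const_smul, eLpNorm_norm, Real.enorm_eq_ofReal hL0]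
      gcongr
      exact eLpNorm_convolution_normed_le _ hf.1.1
  have h6 : ∀ n, eLpNorm (fun x => X n x • F n x) 6 volume
      ≤ SNormLESNormFDerivOfEqConst ℂ (volume : Measure R3) 2 * C := by
    intro n
    refine (eLpNorm_six_le_of_smooth (((hXd n).smul (hFd n)).of_le (by exact_mod_cast le_top))
      ((hXc n).smul_right)).trans ?_
    gcongr
    exact hderC n
  have hae : ∀ᵐ x, Tendsto (fun n => X n x • F n x) atTop (𝓝 (f x)) := by
    have hr : Tendsto (fun n => (φ n).rOut) atTop (𝓝 0) := tendsto_one_div_add_atTop_nhds_zero_nat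
    have h1 := ContDiffBump.ae_convolution_tendsto_right_of_locallyIntegrable (φ := φ) (K := 2) hr
      (Eventually.of_forall fun n => by simp only [φ]; linarith) hfl
    filter_upwards [h1] with x hx
    have h2 : Tendsto (fun n => X n x) atTop (𝓝 1) := by
      have h3 : Tendsto (fun n : ℕ => ((n : ℝ) + 1)⁻¹ • x) atTop (𝓝 0) := by
        have := tendsto_one_div_add_atTop_nhds_zero_nat (𝕜 := ℝ).smul_const x
        simpa using this
      have h4 := (χ.continuous.tendsto 0).comp h3
      rwa [χ.one_of_mem_closedBall (by simp [χ])] at h4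
    simpa using h2.smul hx
  -- Fatou carries the uniform L⁶ bound to the a.e. limit f.
  refine ⟨hf.1.1, (Lp.eLpNorm_lim_le_liminf_eLpNorm
    (fun n => ((hXd n).smul (hFd n)).continuous.aestronglyMeasurable) f hae).trans_lt ?_⟩
  refine lt_of_le_of_lt (liminf_le_of_frequently_le' (Frequently.of_forall h6)) ?_
  exact (ENNReal.mul_ne_top ENNReal.coe_ne_top hCtop).lt_top

/-- Uses t⁴ ≤ t² + t⁶. An energy bound would not do: the coupling may be zero, and then it does not
directly control the quartic term. -/
theorem MemH1.integrable_norm_pow_four {f : R3 → ℂ} (hf : MemH1 f) :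
    Integrable fun x => ‖f x‖ ^ 4 := by
  have h6 : Integrable fun x => ‖f x‖ ^ 6 := by
    simpa using hf.memLp_six.integrable_norm_rpow (by norm_num) (by norm_num)
  refine (hf.1.integrable_norm_sq.add h6).mono' (hf.1.1.norm.pow 4) (ae_of_all _ fun x => ?_)
  rw [Real.norm_of_nonneg (by positivity)]
  simp only [Pi.add_apply]
  nlinarith [sq_nonneg (‖f x‖ * (‖f x‖ ^ 2 - 1)), sq_nonneg (‖f x‖)]

theorem _root_.MeasureTheory.MemLp.eLpNorm_two_sq_eq {f : R3 → ℂ} (hf : MemLp f 2 volume) :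
    eLpNorm f 2 volume ^ 2 = ENNReal.ofReal (∫ x, ‖f x‖ ^ 2) := by
  rw [eLpNorm_two_sq, ofReal_integral_eq_lintegral_ofReal hf.integrable_norm_sq
    (ae_of_all _ fun x => by positivity)]
  simp [ENNReal.ofReal_pow]

theorem _root_.MeasureTheory.MemLp.eLpNorm_two_le {f : R3 → ℂ} (hf : MemLp f 2 volume) {A : ℝ}
    (h : ∫ x, ‖f x‖ ^ 2 ≤ A) : eLpNorm f 2 volume ≤ ENNReal.ofReal (Real.sqrt A) := by
  have hA : 0 ≤ A := (integral_nonneg fun x => by positivity).trans h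
  rw [← ENNReal.pow_le_pow_left_iff two_ne_zero, hf.eLpNorm_two_sq_eq,
    ← ENNReal.ofReal_pow (Real.sqrt_nonneg A), Real.sq_sqrt hA]
  exact ENNReal.ofReal_le_ofReal h

/-! ### Lower semicontinuity from Fatou's lemma. -/

section Fatou

variable {α : Type*} [MeasurableSpace α] {μ : Measure α}

theorem ofReal_integral_le_liminf {f : ℕ → α → ℝ} {F : α → ℝ} (hf : ∀ n, Integrable (f n) μ)
    (h0 : ∀ n x, 0 ≤ f n x) (hlim : ∀ᵐ x ∂μ, Tendsto (fun n => f n x) atTop (𝓝 (F x))) :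
    ∫⁻ x, ENNReal.ofReal (F x) ∂μ ≤ liminf (fun n => ENNReal.ofReal (∫ x, f n x ∂μ)) atTop := by
  calc ∫⁻ x, ENNReal.ofReal (F x) ∂μ
      = ∫⁻ x, liminf (fun n => ENNReal.ofReal (f n x)) atTop ∂μ := by
        refine lintegral_congr_ae ?_
        filter_upwards [hlim] with x hx
        exact ((ENNReal.continuous_ofReal.tendsto _).comp hx).liminf_eq.symm
    _ ≤ liminf (fun n => ∫⁻ x, ENNReal.ofReal (f n x) ∂μ) atTop :=
        lintegral_liminf_le' fun n => (hf n).1.aemeasurable.ennreal_ofReal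
    _ = _ := by
        congr 1
        ext n
        rw [ofReal_integral_eq_lintegral_ofReal (hf n) (ae_of_all _ (h0 n))]

theorem eventually_integral_le_of_tendsto_ae {f : ℕ → α → ℝ} {F : α → ℝ}
    (hf : ∀ n, Integrable (f n) μ) (h0 : ∀ n x, 0 ≤ f n x) (hF : Integrable F μ)
    (hF0 : ∀ x, 0 ≤ F x) (hlim : ∀ᵐ x ∂μ, Tendsto (fun n => f n x) atTop (𝓝 (F x)))
    {ε : ℝ} (hε : 0 < ε) : ∀ᶠ n in atTop, (∫ x, F x ∂μ) - ε ≤ ∫ x, f n x ∂μ := by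
  rcases lt_or_ge ((∫ x, F x ∂μ) - ε) 0 with hneg | hpos
  · exact Eventually.of_forall fun n => hneg.le.trans (integral_nonneg (h0 n))
  have h1 := ofReal_integral_le_liminf hf h0 hlim
  rw [← ofReal_integral_eq_lintegral_ofReal hF (ae_of_all _ hF0)] at h1
  have h2 : ENNReal.ofReal ((∫ x, F x ∂μ) - ε) < ENNReal.ofReal (∫ x, F x ∂μ) :=
    (ENNReal.ofReal_lt_ofReal_iff (by linarith)).2 (by linarith)
  filter_upwards [eventually_lt_of_lt_liminf (h2.trans_le h1)] with n hn
  exact ((ENNReal.ofReal_lt_ofReal_iff_of_nonneg hpos).1 hn).le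

theorem integrable_of_tendsto_ae {f : ℕ → α → ℝ} {F : α → ℝ}
    (hf : ∀ n, Integrable (f n) μ) (h0 : ∀ n x, 0 ≤ f n x) (hF0 : ∀ x, 0 ≤ F x)
    (hFm : AEStronglyMeasurable F μ)
    (hlim : ∀ᵐ x ∂μ, Tendsto (fun n => f n x) atTop (𝓝 (F x)))
    {A : ℝ} (hA : ∀ n, ∫ x, f n x ∂μ ≤ A) : Integrable F μ := by
  refine ⟨hFm, ?_⟩
  rw [hasFiniteIntegral_iff_ofReal (ae_of_all _ hF0)]
  refine (ofReal_integral_le_liminf hf h0 hlim).trans_lt (lt_of_le_of_lt ?_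
    (ENNReal.ofReal_lt_top (r := A)))
  exact liminf_le_of_frequently_le' (Frequently.of_forall fun n => ENNReal.ofReal_le_ofReal (hA n))

end Fatou

/-! ### Compactness of states with bounded energy. -/

theorem kinetic_eq_sum {φ : R3 → ℂ} (h : MemH1 φ) :
    kinetic φ = ∑ k, ∫ x, ‖weakDeriv φ (coordDir k) x‖ ^ 2 :=
  integral_finsetSum _ fun k _ => (h.memLp_weakDeriv (coordDir k)).integrable_norm_sq

theorem kinetic_nonneg (φ : R3 → ℂ) : 0 ≤ kinetic φ :=
  integral_nonneg fun _ => Finset.sum_nonneg fun _ _ => by positivity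

theorem potential_nonneg {V : R3 → ℝ} (hV : ∀ x, 0 < V x) (φ : R3 → ℂ) : 0 ≤ potential V φ :=
  integral_nonneg fun x => mul_nonneg (hV x).le (by positivity)

theorem quartic_nonneg (φ : R3 → ℂ) : 0 ≤ quartic φ :=
  integral_nonneg fun _ => by positivity

/-- Functions in `L²` with bounded potential energy have uniformly small tails. -/
theorem exists_eLpNorm_indicator_compl_ball_le {V : R3 → ℝ} (hV : IsConfining V) (A : ℝ)
    {ε : ℝ≥0∞} (hε : 0 < ε) :
    ∃ R : ℝ, ∀ R' ≥ R, ∀ φ : R3 → ℂ, Integrable (fun x => V x * ‖φ x‖ ^ 2) → potential V φ ≤ A →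
      eLpNorm ((Metric.ball (0 : R3) R')ᶜ.indicator φ) 2 volume ≤ ε := by
  -- Where V ≥ 1/δ, |φ|² ≤ δ V|φ|², so the mass there is at most δA.
  obtain ⟨δ, hδ0, hδ⟩ : ∃ δ : ℝ, 0 < δ ∧ ENNReal.ofReal (δ * A) ≤ ε ^ 2 := by
    have h1 : Tendsto (fun δ : ℝ => ENNReal.ofReal (δ * A)) (𝓝[>] 0) (𝓝 0) := by
      have h2 : Continuous fun δ : ℝ => ENNReal.ofReal (δ * A) :=
      ENNReal.continuous_ofReal.comp (continuous_mul_const A)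
      have := h2.tendsto 0
      simp only [zero_mul, ENNReal.ofReal_zero] at this
      exact this.mono_left nhdsWithin_le_nhds
    obtain ⟨r, h3, h4⟩ := (((ENNReal.tendsto_nhds_zero.1 h1) _
      (ENNReal.pow_pos hε 2)).and self_mem_nhdsWithin).exists
    exact ⟨r, h4, h3⟩
  have hev := hV.tendsto.eventually_ge_atTop δ⁻¹
  rw [← Metric.cobounded_eq_cocompact] at hev
  obtain ⟨R, -, hR⟩ := (Metric.hasBasis_cobounded_compl_ball (0 : R3)).eventually_iff.1 hev
  refine ⟨R, fun R' hR' φ hφ hA => ?_⟩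
  rw [← ENNReal.pow_le_pow_left_iff two_ne_zero, eLpNorm_two_sq]
  calc ∫⁻ x, ‖(Metric.ball (0 : R3) R')ᶜ.indicator φ x‖ₑ ^ 2
      ≤ ∫⁻ x, ENNReal.ofReal (δ * (V x * ‖φ x‖ ^ 2)) := by
        refine lintegral_mono fun x => ?_
        by_cases hx : x ∈ (Metric.ball (0 : R3) R')ᶜ
        · rw [Set.indicator_of_mem hx, ← ofReal_norm, ← ENNReal.ofReal_pow (norm_nonneg _)]
          refine ENNReal.ofReal_le_ofReal ?_
          have h1 : δ⁻¹ ≤ V x := hR (fun h => hx (Metric.ball_subset_ball hR' h))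
          have h2 : 1 ≤ δ * V x := by
            calc 1 = δ * δ⁻¹ := (mul_inv_cancel₀ hδ0.ne').symm
              _ ≤ _ := by gcongr
          nlinarith [sq_nonneg ‖φ x‖]
        · rw [Set.indicator_of_notMem hx]; simp
    _ = ENNReal.ofReal (δ * potential V φ) := by
        rw [potential, ← integral_const_mul, ofReal_integral_eq_lintegral_ofReal
          (hφ.const_mul δ) (ae_of_all _ fun x => ?_)]
        have := hV.pos x
        positivity
    _ ≤ ε ^ 2 := le_trans (ENNReal.ofReal_le_ofReal (by gcongr)) hδ

theorem exists_eLpNorm_indicator_compl_ball_le_of_memLp {f : R3 → ℂ} (hf : MemLp f 2 volume)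
    {ε : ℝ≥0∞} (hε : 0 < ε) :
    ∃ R : ℝ, ∀ R' ≥ R, eLpNorm ((Metric.ball (0 : R3) R')ᶜ.indicator f) 2 volume ≤ ε := by
  obtain ⟨g, hg, hle, -, -⟩ := hf.exists_hasCompactSupport_eLpNorm_sub_le (by norm_num) hε.ne'
  obtain ⟨R, hR⟩ := hg.isCompact.isBounded.subset_ball (0 : R3)
  refine ⟨R, fun R' hR' => le_trans (eLpNorm_mono fun x => ?_) hle⟩
  by_cases hx : x ∈ Metric.ball (0 : R3) R'
  · simp [hx]
  · have : g x = 0 := image_eq_zero_of_notMem_tsupport fun h =>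
      hx (Metric.ball_subset_ball hR' (hR h))
    simp [hx, this]

/-- A sequence of states with bounded energy has a subsequence along which the energies are lower
semicontinuous, with a limit that is again a state. -/
theorem exists_subseq_lower_semicontinuous {V : R3 → ℝ} (hV : IsConfining V) {φ : ℕ → R3 → ℂ}
    (hφ : ∀ n, φ n ∈ nlsStates V) {A : ℝ} (hK : ∀ n, kinetic (φ n) ≤ A)
    (hP : ∀ n, potential V (φ n) ≤ A) :
    ∃ ψ ∈ nlsStates V, ∃ s : ℕ → ℕ, StrictMono s ∧ ∀ ε > 0, ∀ᶠ n in atTop,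
      kinetic ψ - ε ≤ kinetic (φ (s n)) ∧ potential V ψ - ε ≤ potential V (φ (s n)) ∧
      quartic ψ - ε ≤ quartic (φ (s n)) := by
  have hL : ∀ n, MemLp (φ n) 2 volume := fun n => (hφ n).1.1
  have hgL : ∀ n k, MemLp (weakDeriv (φ n) (coordDir k)) 2 volume := fun n k =>
    (hφ n).1.memLp_weakDeriv _
  have hone : ∀ n, eLpNorm (φ n) 2 volume = 1 := fun n => by
    have h := (hL n).eLpNorm_two_sq_eq
    rw [(hφ n).2.1, ENNReal.ofReal_one] at h
    replace h := h.trans (one_pow 2).symm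
    exact le_antisymm ((ENNReal.pow_le_pow_left_iff two_ne_zero).1 h.le)
      ((ENNReal.pow_le_pow_left_iff two_ne_zero).1 h.ge)
  set B := ENNReal.ofReal (Real.sqrt A) with hB
  have hBt : B ≠ ⊤ := ENNReal.ofReal_ne_top
  have hgB : ∀ n k, eLpNorm (weakDeriv (φ n) (coordDir k)) 2 volume ≤ B := fun n k => by
    refine (hgL n k).eLpNorm_two_le (le_trans ?_ (hK n))
    rw [kinetic_eq_sum (hφ n).1]
    exact Finset.single_le_sum (f := fun k => ∫ x, ‖weakDeriv (φ n) (coordDir k) x‖ ^ 2)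
      (fun k _ => integral_nonneg fun x => by positivity) (Finset.mem_univ k)
  obtain ⟨ψ, hψ, s₀, hs₀, hw⟩ := exists_subseq_L2WeakTendsto hL ENNReal.one_ne_top
    fun n => (hone n).le
  obtain ⟨g, s, hs, hg, hwg, hws⟩ : ∃ g : Fin 3 → R3 → ℂ, ∃ s : ℕ → ℕ, StrictMono s ∧
      (∀ k, MemLp (g k) 2 volume) ∧
      (∀ k, L2WeakTendsto (fun n => weakDeriv (φ (s n)) (coordDir k)) (g k)) ∧
      L2WeakTendsto (fun n => φ (s n)) ψ := by
    obtain ⟨g0, h0, s1, hs1, hw0⟩ := exists_subseq_L2WeakTendsto (fun n => hgL (s₀ n) 0) hBt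
      fun n => hgB _ 0
    obtain ⟨g1, h1, s2, hs2, hw1⟩ := exists_subseq_L2WeakTendsto (fun n => hgL (s₀ (s1 n)) 1) hBt
      fun n => hgB _ 1
    obtain ⟨g2, h2, s3, hs3, hw2⟩ := exists_subseq_L2WeakTendsto
      (fun n => hgL (s₀ (s1 (s2 n))) 2) hBt fun n => hgB _ 2
    refine ⟨![g0, g1, g2], fun n => s₀ (s1 (s2 (s3 n))),
      hs₀.comp (hs1.comp (hs2.comp hs3)), fun k => ?_, fun k => ?_,
      hw.comp (hs1.comp (hs2.comp hs3))⟩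
    · fin_cases k <;> assumption
    · fin_cases k
      · exact hw0.comp (hs2.comp hs3)
      · exact hw1.comp hs3
      · exact hw2
  have hψd : ∀ k, IsWeakDeriv ψ (g k) (coordDir k) := fun k =>
    IsWeakDeriv.of_L2WeakTendsto (fun n => (hφ (s n)).1.isWeakDeriv _) hws (hwg k)
  have hψ1 : MemH1 ψ := ⟨hψ, fun u => by
    obtain ⟨G, h1, h2, -⟩ := exists_isWeakDeriv_of_coordDir hψ hg hψd u
    exact ⟨G, h1, h2⟩⟩
  -- Norm convergence is what keeps the limit normalized; weak convergence alone could lose mass.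
  have hstrong : Tendsto (fun n => eLpNorm (φ (s n) - ψ) 2 volume) atTop (𝓝 0) := by
    have hDd : ∀ n k, IsWeakDeriv (φ (s n) - ψ) (weakDeriv (φ (s n)) (coordDir k) - g k)
        (coordDir k) := fun n k =>
      ((hφ (s n)).1.isWeakDeriv _).sub (hψd k) (hL _) (hgL _ k) hψ (hg k)
    have hCt : ∑ k, (B + eLpNorm (g k) 2 volume) ≠ ⊤ :=
      ENNReal.sum_ne_top.2 fun k _ => ENNReal.add_ne_top.2 ⟨hBt, (hg k).eLpNorm_ne_top⟩
    refine tendsto_eLpNorm_of_L2WeakTendsto_zero (fun n => (hL _).sub hψ)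
      (M := 1 + eLpNorm ψ 2 volume) (C := ∑ k, (B + eLpNorm (g k) 2 volume))
      (ENNReal.add_ne_top.2 ⟨ENNReal.one_ne_top, hψ.eLpNorm_ne_top⟩) hCt (fun n => ?_)
      (fun n u => ?_) (fun ε hε => ?_) ?_
    · exact (eLpNorm_sub_le (hL _).1 hψ.1 (by norm_num)).trans (by rw [hone])
    · obtain ⟨G, h1, h2, h3⟩ := exists_isWeakDeriv_of_coordDir ((hL _).sub hψ)
        (fun k => (hgL (s n) k).sub (hg k)) (hDd n) u
      refine ⟨G, h1, h2, h3.trans ?_⟩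
      gcongr with k
      exact (eLpNorm_sub_le (hgL _ k).1 (hg k).1 (by norm_num)).trans (by gcongr; exact hgB _ k)
    · have hε2 : 0 < ε / 2 := ENNReal.half_pos hε.ne'
      obtain ⟨R₁, hR₁⟩ := exists_eLpNorm_indicator_compl_ball_le hV A hε2
      obtain ⟨R₂, hR₂⟩ := exists_eLpNorm_indicator_compl_ball_le_of_memLp hψ hε2
      refine ⟨max R₁ R₂, fun n => ?_⟩
      rw [Set.indicator_sub']
      refine (eLpNorm_sub_le ((hL _).1.indicator measurableSet_ball.compl)
        (hψ.1.indicator measurableSet_ball.compl) (by norm_num)).trans ?_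
      rw [← ENNReal.add_halves ε]
      exact add_le_add (hR₁ _ (le_max_left _ _) _ (hφ _).2.2.1 (hP _)) (hR₂ _ (le_max_right _ _))
    · intro h hh
      have h1 := (hws h hh).sub_const (∫ x, h x * ψ x)
      rw [sub_self] at h1
      simp only [Pi.zero_apply, mul_zero, integral_zero, Pi.sub_apply, mul_sub]
      refine h1.congr fun n => ?_
      rw [integral_sub (integrable_mul_of_memLp_two (hL _) hh)
        (integrable_mul_of_memLp_two hψ hh)]
  have hψone : ∫ x, ‖ψ x‖ ^ 2 = 1 := by
    have h1 : eLpNorm ψ 2 volume = 1 := by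
      refine le_antisymm ?_ ?_
      · have h2 : Tendsto (fun n => eLpNorm (φ (s n) - ψ) 2 volume + 1) atTop (𝓝 (0 + 1)) :=
          hstrong.add_const 1
        rw [zero_add] at h2
        refine ge_of_tendsto' h2 fun n => ?_
        have h3 := eLpNorm_sub_le (((hL (s n)).sub hψ)).1 (hL (s n)).1 (p := 2) (by norm_num)
        rw [sub_sub_cancel_left, eLpNorm_neg, hone] at h3
        exact h3
      · have h2 : Tendsto (fun n => eLpNorm (φ (s n) - ψ) 2 volume + eLpNorm ψ 2 volume) atTop
          (𝓝 (0 + eLpNorm ψ 2 volume)) := hstrong.add_const _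
        rw [zero_add] at h2
        refine ge_of_tendsto' h2 fun n => ?_
        have h3 := eLpNorm_add_le (((hL (s n)).sub hψ)).1 hψ.1 (p := 2) (by norm_num)
        rwa [sub_add_cancel, hone] at h3
    have h2 := hψ.eLpNorm_two_sq_eq
    rw [h1, one_pow, eq_comm, ENNReal.ofReal_eq_one] at h2
    exact h2
  -- A further subsequence converges a.e.; Fatou then handles the potential and quartic terms, weak
  -- convergence the kinetic one.
  obtain ⟨t, ht, hae⟩ := (tendstoInMeasure_of_tendsto_eLpNorm (p := 2) (by norm_num)
    (fun n => (hL (s n)).1) hψ.1 hstrong).exists_seq_tendsto_ae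
  have hPint : ∀ n, Integrable fun x => V x * ‖φ (s (t n)) x‖ ^ 2 := fun n => (hφ _).2.2.1
  have hP0 : ∀ (f : R3 → ℂ) x, 0 ≤ V x * ‖f x‖ ^ 2 := fun f x =>
    mul_nonneg (hV.pos x).le (by positivity)
  have haeP : ∀ᵐ x, Tendsto (fun n => V x * ‖φ (s (t n)) x‖ ^ 2) atTop (𝓝 (V x * ‖ψ x‖ ^ 2)) := by
    filter_upwards [hae] with x hx using (hx.norm.pow 2).const_mul _
  have haeQ : ∀ᵐ x, Tendsto (fun n => ‖φ (s (t n)) x‖ ^ 4) atTop (𝓝 (‖ψ x‖ ^ 4)) := by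
    filter_upwards [hae] with x hx using hx.norm.pow 4
  have hψP : Integrable fun x => V x * ‖ψ x‖ ^ 2 :=
    integrable_of_tendsto_ae hPint (fun n => hP0 _) (hP0 ψ)
      (hV.continuous.aestronglyMeasurable.mul (hψ.1.norm.pow 2)) haeP (fun n => hP _)
  have hψQ := hψ1.integrable_norm_pow_four
  refine ⟨ψ, ⟨hψ1, hψone, hψP, hψQ⟩, fun n => s (t n), hs.comp ht, fun ε hε => ?_⟩
  have hkin : ∀ᶠ n in atTop, kinetic ψ - ε ≤ kinetic (φ (s (t n))) := by
    have h1 : ∀ k, ∀ᶠ n in atTop, (∫ x, ‖g k x‖ ^ 2) - ε / 3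
        ≤ ∫ x, ‖weakDeriv (φ (s (t n))) (coordDir k) x‖ ^ 2 := fun k =>
      ((hwg k).comp ht).eventually_integral_sq_le (fun n => hgL _ k) (hg k) (by positivity)
    have h2 : ∀ k, ∫ x, ‖weakDeriv ψ (coordDir k) x‖ ^ 2 = ∫ x, ‖g k x‖ ^ 2 := fun k => by
      refine integral_congr_ae ?_
      filter_upwards [(hψ1.isWeakDeriv (coordDir k)).unique (hψd k) (hψ1.memLp_weakDeriv _) (hg k)]
        with x hx
      rw [hx]
    filter_upwards [eventually_all.2 h1] with n hn
    rw [kinetic_eq_sum hψ1, kinetic_eq_sum (hφ _).1]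
    simp only [h2, Fin.sum_univ_three]
    linarith [hn 0, hn 1, hn 2]
  filter_upwards [hkin, eventually_integral_le_of_tendsto_ae hPint (fun n => hP0 _) hψP (hP0 ψ)
    haeP hε, eventually_integral_le_of_tendsto_ae (fun n => (hφ (s (t n))).2.2.2)
    (fun n x => by positivity) hψQ (fun x => by positivity) haeQ hε] with n h1 h2 h3
  exact ⟨h1, h2, h3⟩

/-! ### Minimizing sequences and the Feynman–Hellmann argument. -/

/-- An excess in a would need a deficit in b or c, which their lower bounds exclude. -/
theorem tendsto_of_lower_bounds_of_add_tendsto {a b c : ℕ → ℝ} {a' b' c' : ℝ}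
    (ha : ∀ ε > 0, ∀ᶠ n in atTop, a' - ε ≤ a n) (hb : ∀ ε > 0, ∀ᶠ n in atTop, b' - ε ≤ b n)
    (hc : ∀ ε > 0, ∀ᶠ n in atTop, c' - ε ≤ c n)
    (h : Tendsto (fun n => a n + b n + c n) atTop (𝓝 (a' + b' + c'))) :
    Tendsto a atTop (𝓝 a') := by
  rw [Metric.tendsto_atTop'] at h ⊢
  intro ε hε
  have h1 := ha (ε / 4) (by positivity)
  have h2 := hb (ε / 4) (by positivity)
  have h3 := hc (ε / 4) (by positivity)
  obtain ⟨N, hN⟩ := h (ε / 4) (by positivity)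
  obtain ⟨M, hM⟩ := eventually_atTop.1 (h1.and (h2.and h3))
  refine ⟨max N M, fun n hn => ?_⟩
  have hN' := hN n (lt_of_le_of_lt (le_max_left _ _) hn)
  obtain ⟨m1, m2, m3⟩ := hM n ((le_max_right _ _).trans hn.le)
  rw [Real.dist_eq, abs_lt] at hN' ⊢
  constructor <;> linarith

theorem potential_congr_phase (V : R3 → ℝ) {φ ψ : R3 → ℂ} {c : ℂ} (hc : ‖c‖ = 1)
    (h : ψ =ᵐ[volume] fun x => c * φ x) : potential V ψ = potential V φ :=
  integral_congr_ae (by filter_upwards [h] with x hx; rw [hx, norm_mul, hc, one_mul])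

theorem quartic_congr_phase {φ ψ : R3 → ℂ} {c : ℂ} (hc : ‖c‖ = 1)
    (h : ψ =ᵐ[volume] fun x => c * φ x) : quartic ψ = quartic φ :=
  integral_congr_ae (by filter_upwards [h] with x hx; rw [hx, norm_mul, hc, one_mul])

/-- Along a minimizing sequence, potential and interaction energies converge to those of the
unique minimizer. -/
theorem tendsto_of_minimizing_sequence {V : R3 → ℝ} (hV : IsConfining V) {g : ℝ} (hg : 0 ≤ g)
    {φ : R3 → ℂ} (hφ : IsNlsMinimizer V g 1 1 φ) (hu : HasUniqueNlsMinimizer V g 1 1)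
    {f : ℕ → R3 → ℂ} (hf : ∀ n, f n ∈ nlsStates V)
    (hlim : Tendsto (fun n => nlsEnergy V g 1 1 (f n)) atTop (𝓝 (nlsEnergy V g 1 1 φ))) :
    Tendsto (fun n => potential V (f n)) atTop (𝓝 (potential V φ)) ∧
      Tendsto (fun n => g * quartic (f n)) atTop (𝓝 (g * quartic φ)) := by
  have key : ∀ ns : ℕ → ℕ, Tendsto ns atTop atTop → ∃ ms : ℕ → ℕ,
      Tendsto (fun n => potential V (f (ns (ms n)))) atTop (𝓝 (potential V φ)) ∧
      Tendsto (fun n => g * quartic (f (ns (ms n)))) atTop (𝓝 (g * quartic φ)) := by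
    intro ns hns
    have hlim' := hlim.comp hns
    obtain ⟨A, hA⟩ := hlim'.bddAbove_range
    have hA' : ∀ n, nlsEnergy V g 1 1 (f (ns n)) ≤ A := fun n => hA ⟨n, rfl⟩
    have hsum : ∀ n, kinetic (f (ns n)) + potential V (f (ns n)) + g * quartic (f (ns n)) ≤ A :=
      fun n => by simpa only [nlsEnergy, one_mul] using hA' n
    have hQ0 : ∀ n, 0 ≤ g * quartic (f n) := fun n => mul_nonneg hg (quartic_nonneg _)
    obtain ⟨ψ, hψ, s, hs, hlsc⟩ := exists_subseq_lower_semicontinuous hV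
      (φ := fun n => f (ns n)) (A := A) (fun n => hf _)
      (fun n => by linarith [hsum n, hQ0 (ns n), potential_nonneg hV.pos (f (ns n))])
      (fun n => by linarith [hsum n, hQ0 (ns n), kinetic_nonneg (f (ns n))])
    have hlimK : ∀ ε > 0, ∀ᶠ n in atTop, kinetic ψ - ε ≤ kinetic (f (ns (s n))) :=
      fun ε hε => (hlsc ε hε).mono fun n h => h.1
    have hlimP : ∀ ε > 0, ∀ᶠ n in atTop, potential V ψ - ε ≤ potential V (f (ns (s n))) :=
      fun ε hε => (hlsc ε hε).mono fun n h => h.2.1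
    have hlimQ : ∀ ε > 0, ∀ᶠ n in atTop,
        g * quartic ψ - ε ≤ g * quartic (f (ns (s n))) := fun ε hε => by
      -- The denominator is g + 1 because g may vanish.
      filter_upwards [hlsc (ε / (g + 1)) (by positivity)] with n h
      have h1 : g * (ε / (g + 1)) ≤ ε := by
        rw [mul_div_assoc', div_le_iff₀ (by positivity)]
        nlinarith
      nlinarith [h.2.2, mul_le_mul_of_nonneg_left h.2.2 hg]
    have hE := hlim'.comp hs.tendsto_atTop
    have hle : nlsEnergy V g 1 1 ψ ≤ nlsEnergy V g 1 1 φ := by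
      refine le_of_forall_pos_le_add fun ε hε => ?_
      suffices nlsEnergy V g 1 1 ψ - ε ≤ nlsEnergy V g 1 1 φ by linarith
      refine ge_of_tendsto hE ?_
      filter_upwards [hlimK (ε / 3) (by positivity), hlimP (ε / 3) (by positivity),
        hlimQ (ε / 3) (by positivity)] with n h1 h2 h3
      simp only [Function.comp_apply, nlsEnergy, one_mul]
      linarith
    have heq : nlsEnergy V g 1 1 ψ = nlsEnergy V g 1 1 φ := le_antisymm hle (hφ.2 hψ)
    have hψm : IsNlsMinimizer V g 1 1 ψ := ⟨hψ, fun χ hχ => hle.trans (hφ.2 hχ)⟩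
    obtain ⟨c, hc, hae⟩ := hu.2 φ ψ hφ hψm
    have hPeq := potential_congr_phase V hc hae
    have hQeq := quartic_congr_phase hc hae
    rw [← heq] at hE
    refine ⟨s, ?_, ?_⟩
    · rw [← hPeq]
      refine tendsto_of_lower_bounds_of_add_tendsto hlimP hlimK hlimQ ?_
      convert! hE using 2
      · simp only [Function.comp_apply, nlsEnergy]; ring
      · simp only [nlsEnergy]; ring
    · rw [← hQeq]
      refine tendsto_of_lower_bounds_of_add_tendsto hlimQ hlimK hlimP ?_
      convert! hE using 2
      · simp only [Function.comp_apply, nlsEnergy]; ring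
      · simp only [nlsEnergy]; ring
  exact ⟨tendsto_of_subseq_tendsto fun ns hns => (key ns hns).imp fun _ h => h.1,
    tendsto_of_subseq_tendsto fun ns hns => (key ns hns).imp fun _ h => h.2⟩

/-- Feynman–Hellmann: if `e N` has supergradient `p N` at `1` (for parameters near `1`), and the
limiting energy `E` satisfies `E 1 + (l - 1) q l ≤ E l` with `q` continuous at `1`, then `p N`
converges to the limit of `q` at `1`. -/
theorem tendsto_supergradient {e : ℕ → ℝ → ℝ} {E : ℝ → ℝ} {p : ℕ → ℝ} {q : ℝ → ℝ} {P : ℝ}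
    (he : ∀ᶠ l in 𝓝 (1 : ℝ), Tendsto (fun N => e N l) atTop (𝓝 (E l)))
    (hle : ∀ᶠ l in 𝓝 (1 : ℝ), ∀ N, e N l ≤ e N 1 + (l - 1) * p N)
    (hE : ∀ᶠ l in 𝓝 (1 : ℝ), E 1 + (l - 1) * q l ≤ E l)
    (hq : Tendsto q (𝓝 1) (𝓝 P)) : Tendsto p atTop (𝓝 P) := by
  have hall := he.and (hle.and hE)
  have h1 := he.self_of_nhds
  rw [tendsto_order]
  constructor
  · intro a ha
    have hq' := hq.eventually (lt_mem_nhds ha)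
    obtain ⟨l, ⟨⟨hl1, hl2, hl3⟩, hl4⟩, hl5⟩ : ∃ l, (((Tendsto (fun N => e N l) atTop (𝓝 (E l))) ∧
        (∀ N, e N l ≤ e N 1 + (l - 1) * p N) ∧ E 1 + (l - 1) * q l ≤ E l) ∧ a < q l) ∧ 1 < l :=
      (((hall.and hq').filter_mono nhdsWithin_le_nhds).and
        (self_mem_nhdsWithin (s := Set.Ioi (1 : ℝ)))).exists
    -- For l > 1: (l - 1) a < (l - 1) q l ≤ E l - E 1, the limit of e N l - e N 1, which is at most
    -- (l - 1) p N. For l < 1, dividing by l - 1 reverses the conclusion.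
    have h2 : (l - 1) * a < E l - E 1 := by nlinarith
    filter_upwards [(hl1.sub h1).eventually (lt_mem_nhds h2)] with N hN
    have h3 := hl2 N
    have h4 : (l - 1) * a < (l - 1) * p N := by linarith
    exact lt_of_mul_lt_mul_left h4 (by linarith)
  · intro a ha
    have hq' := hq.eventually (gt_mem_nhds ha)
    obtain ⟨l, ⟨⟨hl1, hl2, hl3⟩, hl4⟩, hl5⟩ : ∃ l, (((Tendsto (fun N => e N l) atTop (𝓝 (E l))) ∧
        (∀ N, e N l ≤ e N 1 + (l - 1) * p N) ∧ E 1 + (l - 1) * q l ≤ E l) ∧ q l < a) ∧ l < 1 :=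
      (((hall.and hq').filter_mono nhdsWithin_le_nhds).and
        (self_mem_nhdsWithin (s := Set.Iio (1 : ℝ)))).exists
    have h2 : (l - 1) * a < E l - E 1 := by nlinarith
    filter_upwards [(hl1.sub h1).eventually (lt_mem_nhds h2)] with N hN
    have h3 := hl2 N
    have h4 : (1 - l) * p N < (1 - l) * a := by nlinarith
    exact lt_of_mul_lt_mul_left h4 (by linarith)

theorem IsNlsMinimizer.nlsMinEnergy_eq {V : R3 → ℝ} {g a b : ℝ} {φ : R3 → ℂ}
    (h : IsNlsMinimizer V g a b φ) : nlsMinEnergy V g a b = nlsEnergy V g a b φ :=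
  IsLeast.csInf_eq ⟨⟨φ, h.1, rfl⟩, by rintro _ ⟨χ, hχ, rfl⟩; exact h.2 hχ⟩

/-- Continuity at `lam = 1` of the parts of the energy of the minimizers, when a functional of the
form `E + (lam - 1) W` is minimized. -/
theorem exists_supergradient {S : Set (R3 → ℂ)} {E : ℝ → (R3 → ℂ) → ℝ} {W : (R3 → ℂ) → ℝ}
    (hEW : ∀ l f, E l f = E 1 f + (l - 1) * W f) (hW0 : ∀ f, 0 ≤ W f) (hWE : ∀ f, W f ≤ E 1 f)
    {φ : R3 → ℂ} (hφ : φ ∈ S) (hφm : IsMinOn (E 1) S φ)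
    (hex : ∀ᶠ l in 𝓝 (1 : ℝ), ∃ f ∈ S, IsMinOn (E l) S f)
    (hcomp : ∀ f : ℕ → R3 → ℂ, (∀ n, f n ∈ S) →
      Tendsto (fun n => E 1 (f n)) atTop (𝓝 (E 1 φ)) → Tendsto (fun n => W (f n)) atTop (𝓝 (W φ))) :
    ∃ q : ℝ → ℝ, Tendsto q (𝓝 1) (𝓝 (W φ)) ∧
      ∀ᶠ l in 𝓝 (1 : ℝ), sInf (E 1 '' S) + (l - 1) * q l ≤ sInf (E l '' S) := by
  classical
  have hmin : ∀ {l f}, f ∈ S → IsMinOn (E l) S f → sInf (E l '' S) = E l f := fun {l f} hf hm =>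
    IsLeast.csInf_eq ⟨⟨f, hf, rfl⟩, by rintro _ ⟨χ, hχ, rfl⟩; exact hm hχ⟩
  -- The default φ puts F l in S for every l, so that `hcomp` applies to any sequence of parameters.
  set F : ℝ → R3 → ℂ := fun l => if h : ∃ f ∈ S, IsMinOn (E l) S f then h.choose else φ with hF
  have hFS : ∀ l, F l ∈ S := by
    intro l
    by_cases h : ∃ f ∈ S, IsMinOn (E l) S f
    · simp only [hF, dif_pos h]; exact h.choose_spec.1
    · simp only [hF, dif_neg h]; exact hφ
  have hFm : ∀ᶠ l in 𝓝 (1 : ℝ), IsMinOn (E l) S (F l) := by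
    filter_upwards [hex] with l h
    simp only [hF, dif_pos h]; exact h.choose_spec.2
  -- Comparing F l with φ at l gives E 1 (F l) ≤ E 1 φ + |l - 1| (W φ + W (F l)). With |l - 1| < 1/2
  -- and W ≤ E 1, half of E 1 (F l) is absorbed, leaving W (F l) ≤ 3 E 1 φ; the 4 is generous.
  have hbound : ∀ᶠ l in 𝓝 (1 : ℝ), E 1 (F l) ≤ E 1 φ + |l - 1| * (4 * E 1 φ + W φ) := by
    have hnear : ∀ᶠ l in 𝓝 (1 : ℝ), |l - 1| < 1 / 2 := by
      have := Metric.ball_mem_nhds (1 : ℝ) (show (0 : ℝ) < 1 / 2 by norm_num)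
      filter_upwards [this] with l hl
      simpa [Real.dist_eq] using hl
    filter_upwards [hFm, hnear] with l hl hn
    have h1 : E l (F l) ≤ E l φ := hl hφ
    rw [hEW l (F l), hEW l φ] at h1
    have h2 := hW0 (F l)
    have h3 := hWE (F l)
    have h4 := hW0 φ
    have h5 := hWE φ
    have h6 := abs_nonneg (l - 1)
    have h7 : (l - 1) * W φ ≤ |l - 1| * W φ := mul_le_mul_of_nonneg_right (le_abs_self _) h4
    have h8 : -((l - 1) * W (F l)) ≤ |l - 1| * W (F l) := by
      rw [← neg_mul]; exact mul_le_mul_of_nonneg_right (neg_le_abs _) h2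
    have h9 : W (F l) ≤ 4 * E 1 φ := by nlinarith
    nlinarith
  have hEF : Tendsto (fun l => E 1 (F l)) (𝓝 1) (𝓝 (E 1 φ)) := by
    have hup : Tendsto (fun l : ℝ => E 1 φ + |l - 1| * (4 * E 1 φ + W φ)) (𝓝 1) (𝓝 (E 1 φ)) := by
      have : Continuous fun l : ℝ => E 1 φ + |l - 1| * (4 * E 1 φ + W φ) := by fun_prop
      simpa using this.tendsto 1
    exact tendsto_of_tendsto_of_tendsto_of_le_of_le' tendsto_const_nhds hup
      (Eventually.of_forall fun l => hφm (hFS l)) hbound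
  refine ⟨fun l => W (F l), ?_, ?_⟩
  · rw [tendsto_iff_seq_tendsto]
    intro u hu
    exact hcomp (fun n => F (u n)) (fun n => hFS _) (hEF.comp hu)
  · filter_upwards [hFm] with l hl
    rw [hmin hφ hφm, hmin (hFS l) hl, hEW l (F l)]
    have : E 1 φ ≤ E 1 (F l) := hφm (hFS l)
    linarith

/-! ### Permutation symmetry of the one- and two-particle energies. -/

section Permutation

variable {N : ℕ}

/-- Relabelling of the particles, `X ↦ X ∘ σ`. -/
noncomputable def relabel (σ : Equiv.Perm (Fin N)) : Config N ≃L[ℝ] Config N :=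
  (LinearEquiv.funCongrLeft ℝ R3 σ).toContinuousLinearEquiv

theorem relabel_apply (σ : Equiv.Perm (Fin N)) (X : Config N) : relabel σ X = X ∘ σ := rfl

theorem measurePreserving_relabel (σ : Equiv.Perm (Fin N)) :
    MeasurePreserving (relabel σ) := by
  have h := volume_measurePreserving_piCongrLeft (fun _ : Fin N => R3) σ.symm
  convert! h using 1
  ext X i : 2
  rw [relabel_apply, MeasurableEquiv.coe_piCongrLeft]
  have := Equiv.piCongrLeft_apply_apply (fun _ : Fin N => R3) σ.symm X (σ i)
  simpa using this.symm

theorem integral_comp_relabel {F : Type*} [NormedAddCommGroup F] [NormedSpace ℝ F]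
    (σ : Equiv.Perm (Fin N)) (f : Config N → F) : ∫ X, f (relabel σ X) = ∫ X, f X :=
  (measurePreserving_relabel σ).integral_comp
    (relabel σ).toHomeomorph.measurableEmbedding f

theorem relabel_single (σ : Equiv.Perm (Fin N)) (i : Fin N) (e : R3) :
    relabel σ (Pi.single (σ i) e) = Pi.single i e := by
  ext j : 1
  rw [relabel_apply, Function.comp_apply]
  by_cases h : j = i
  · simp [h]
  · rw [Pi.single_eq_of_ne h, Pi.single_eq_of_ne fun h' => h (σ.injective h')]

theorem IsWeakDeriv.comp_relabel {Ψ g : Config N → ℂ} (σ : Equiv.Perm (Fin N)) {u : Config N}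
    (h : IsWeakDeriv Ψ g (relabel σ u)) :
    IsWeakDeriv (fun X => Ψ (relabel σ X)) (fun X => g (relabel σ X)) u := by
  intro η hη hc
  set T := relabel σ
  have hζ : ContDiff ℝ ∞ fun X => η (T.symm X) := hη.comp T.symm.contDiff
  have hζc : HasCompactSupport fun X => η (T.symm X) :=
    hc.comp_homeomorph T.symm.toHomeomorph
  have h1 := h _ hζ hζc
  rw [← integral_comp_relabel σ, ← integral_comp_relabel σ (fun X => η (T.symm X) • g X)] at h1
  have h2 : ∀ X, fderiv ℝ (fun X => η (T.symm X)) (T X) (T u) = fderiv ℝ η X u := by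
    intro X
    have hd : HasFDerivAt η (fderiv ℝ η X) (T.symm (T X)) := by
      rw [T.symm_apply_apply]
      exact ((hη.differentiable (by simp)) X).hasFDerivAt
    have := hd.comp (T X) (T.symm : Config N →L[ℝ] Config N).hasFDerivAt
    have h3 : HasFDerivAt (fun X => η (T.symm X)) _ (T X) := this
    rw [h3.fderiv]
    simp
  simpa only [T, h2, ContinuousLinearEquiv.symm_apply_apply] using h1

/-- Relabelling fixes Ψ a.e. and carries direction σ i to direction i, so uniqueness of weak
derivatives matches the chosen representatives. -/
theorem kineticAt_perm {Ψ : Config N → ℂ}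
    (hsymm : ∀ σ : Equiv.Perm (Fin N), (fun X : Config N => Ψ (X ∘ σ)) =ᵐ[volume] Ψ)
    (hΨ : MemH1 Ψ) (σ : Equiv.Perm (Fin N)) (i : Fin N) :
    kineticAt Ψ (σ i) = kineticAt Ψ i := by
  have h1 : ∀ k, weakDeriv Ψ (Pi.single (σ i) (coordDir k)) =ᵐ[volume]
      fun X => weakDeriv Ψ (Pi.single i (coordDir k)) (relabel σ X) := by
    intro k
    refine (hΨ.isWeakDeriv _).unique ?_ (hΨ.memLp_weakDeriv _)
      ((hΨ.memLp_weakDeriv _).comp_measurePreserving (measurePreserving_relabel σ))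
    refine IsWeakDeriv.congr_ae (IsWeakDeriv.comp_relabel σ ?_) (hsymm σ) EventuallyEq.rfl
    rw [relabel_single]
    exact hΨ.isWeakDeriv _
  rw [kineticAt, kineticAt,
    ← integral_comp_relabel σ fun X => ∑ k, ‖weakDeriv Ψ (Pi.single i (coordDir k)) X‖ ^ 2]
  refine integral_congr_ae ?_
  filter_upwards [ae_all_iff.2 h1] with X hX
  simp only [hX]

theorem potentialAt_perm {Ψ : Config N → ℂ}
    (hsymm : ∀ σ : Equiv.Perm (Fin N), (fun X : Config N => Ψ (X ∘ σ)) =ᵐ[volume] Ψ)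
    (V : R3 → ℝ) (σ : Equiv.Perm (Fin N)) (i : Fin N) :
    potentialAt V Ψ (σ i) = potentialAt V Ψ i := by
  rw [potentialAt, potentialAt, ← integral_comp_relabel σ fun X => V (X i) * ‖Ψ X‖ ^ 2]
  refine integral_congr_ae ?_
  filter_upwards [hsymm σ] with X hX
  rw [relabel_apply, hX]
  rfl

theorem interactionAt_perm {Ψ : Config N → ℂ}
    (hsymm : ∀ σ : Equiv.Perm (Fin N), (fun X : Config N => Ψ (X ∘ σ)) =ᵐ[volume] Ψ)
    (v : R3 → ℝ) (σ : Equiv.Perm (Fin N)) (i j : Fin N) :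
    interactionAt v Ψ (σ i) (σ j) = interactionAt v Ψ i j := by
  rw [interactionAt, interactionAt,
    ← integral_comp_relabel σ fun X => v (X i - X j) * ‖Ψ X‖ ^ 2]
  refine integral_congr_ae ?_
  filter_upwards [hsymm σ] with X hX
  rw [relabel_apply, hX]
  rfl

end Permutation

/-! ### Energy per particle and trial states. -/

/-- By symmetry every particle contributes like particle 0. Summing over ordered pairs counts each
pair twice, whence the factor 1/2. -/
theorem nBodyEnergy_eq {n : ℕ} {V v : R3 → ℝ} {Ψ : Config (n + 1) → ℂ}
    (hΨ : Ψ ∈ nBodyStates (n + 1) V v) (a b : ℝ) :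
    nBodyEnergy V v a b Ψ = ((n + 1 : ℕ) : ℝ) * (kineticAt Ψ 0 + a * potentialAt V Ψ 0 +
      b * ((1 / 2) * ∑ j ∈ Finset.univ.erase (0 : Fin (n + 1)), interactionAt v Ψ 0 j)) := by
  obtain ⟨hH, -, hs, -⟩ := hΨ
  have hK : ∀ i, kineticAt Ψ i = kineticAt Ψ 0 := fun i => by
    simpa using kineticAt_perm hs hH (Equiv.swap 0 i) 0
  have hP : ∀ i, potentialAt V Ψ i = potentialAt V Ψ 0 := fun i => by
    simpa using potentialAt_perm hs V (Equiv.swap 0 i) 0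
  have hI : ∀ i j, interactionAt v Ψ j i = interactionAt v Ψ i j := fun i j => by
    simpa using interactionAt_perm hs v (Equiv.swap i j) i j
  have hrow : ∀ i, ∑ j ∈ ({i}ᶜ : Finset (Fin (n + 1))), interactionAt v Ψ j i
      = ∑ j ∈ Finset.univ.erase (0 : Fin (n + 1)), interactionAt v Ψ 0 j := by
    intro i
    -- The transposition of 0 and i carries the partners of i to the partners of 0.
    refine Finset.sum_bij (fun j _ => Equiv.swap 0 i j) ?_ ?_ ?_ ?_
    · intro j hj
      simp only [Finset.mem_compl, Finset.mem_singleton] at hj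
      simp only [Finset.mem_erase, Finset.mem_univ, and_true]
      intro h
      exact hj (by simpa using congrArg (Equiv.swap 0 i) h)
    · intro j _ k _ h
      exact (Equiv.swap 0 i).injective h
    · intro j hj
      refine ⟨Equiv.swap 0 i j, ?_, by simp⟩
      simp only [Finset.mem_erase, Finset.mem_univ, and_true] at hj
      simp only [Finset.mem_compl, Finset.mem_singleton]
      intro h
      exact hj (by simpa using congrArg (Equiv.swap 0 i) h)
    · intro j _
      rw [hI]
      simpa using (interactionAt_perm hs v (Equiv.swap 0 i) i j).symm
  have hpairs : ∑ i, ∑ j ∈ Finset.Ioi i, interactionAt v Ψ i j = ((n + 1 : ℕ) : ℝ) *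
      ((1 / 2) * ∑ j ∈ Finset.univ.erase (0 : Fin (n + 1)), interactionAt v Ψ 0 j) := by
    have h1 := Finset.sum_sum_Ioi_add_eq_sum_sum_off_diag fun i j => interactionAt v Ψ i j
    simp only [hrow, Finset.sum_const, Finset.card_univ, Fintype.card_fin, nsmul_eq_mul] at h1
    have h2 : ∑ i, ∑ j ∈ Finset.Ioi i, (interactionAt v Ψ j i + interactionAt v Ψ i j)
        = 2 * ∑ i, ∑ j ∈ Finset.Ioi i, interactionAt v Ψ i j := by
      rw [Finset.mul_sum]
      refine Finset.sum_congr rfl fun i _ => ?_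
      rw [Finset.mul_sum]
      refine Finset.sum_congr rfl fun j _ => ?_
      rw [hI i j, two_mul]
    rw [h2] at h1
    linarith
  rw [nBodyEnergy, hpairs]
  simp only [hK, hP, Finset.sum_const, Finset.card_univ, Fintype.card_fin, nsmul_eq_mul]
  ring

theorem pairPotential_nonneg (β : ℝ) {v₀ : R3 → ℝ} (hv : ∀ x, 0 ≤ v₀ x) {N : ℕ} (hN : 1 ≤ N)
    (r : R3) : 0 ≤ pairPotential β v₀ N r := by
  have h1 : (1 : ℝ) ≤ N := by exact_mod_cast hN
  exact mul_nonneg (div_nonneg (by positivity) (by linarith)) (hv _)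

theorem nBodyEnergy_nonneg {N : ℕ} {V v : R3 → ℝ} (hV : ∀ x, 0 ≤ V x) (hv : ∀ x, 0 ≤ v x)
    {a b : ℝ} (ha : 0 ≤ a) (hb : 0 ≤ b) (Ψ : Config N → ℂ) : 0 ≤ nBodyEnergy V v a b Ψ := by
  refine add_nonneg (Finset.sum_nonneg fun i _ => add_nonneg ?_ (mul_nonneg ha ?_))
    (mul_nonneg hb (Finset.sum_nonneg fun i _ => Finset.sum_nonneg fun j _ => ?_))
  · exact integral_nonneg fun X => Finset.sum_nonneg fun _ _ => by positivity
  · exact integral_nonneg fun X => mul_nonneg (hV _) (by positivity)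
  · exact integral_nonneg fun X => mul_nonneg (hv _) (by positivity)

theorem nBodyMinEnergy_le {N : ℕ} {V v : R3 → ℝ} (hV : ∀ x, 0 ≤ V x) (hv : ∀ x, 0 ≤ v x)
    {a b : ℝ} (ha : 0 ≤ a) (hb : 0 ≤ b) {Ψ : Config N → ℂ} (hΨ : Ψ ∈ nBodyStates N V v) :
    nBodyMinEnergy N V v a b ≤ nBodyEnergy V v a b Ψ :=
  csInf_le ⟨0, by rintro _ ⟨χ, -, rfl⟩; exact nBodyEnergy_nonneg hV hv ha hb χ⟩ ⟨Ψ, hΨ, rfl⟩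

theorem IsGroundState.nBodyMinEnergy_eq {N : ℕ} {V v : R3 → ℝ} {Ψ : Config N → ℂ}
    (h : IsGroundState V v Ψ) : nBodyMinEnergy N V v 1 1 = nBodyEnergy V v 1 1 Ψ :=
  IsLeast.csInf_eq ⟨⟨Ψ, h.1, rfl⟩, by rintro _ ⟨χ, hχ, rfl⟩; exact h.2 hχ⟩

theorem coupling_nonneg {v₀ : R3 → ℝ} (hv : ∀ x, 0 ≤ v₀ x) : 0 ≤ coupling v₀ :=
  mul_nonneg (by norm_num) (integral_nonneg hv)

end BoseGas

/-! ### Conclusion. -/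

open BoseGas in
theorem theorem2 (β : ℝ) (hβ0 : 0 < β) (hβ1 : β < 1)
    (V v₀ : R3 → ℝ) (h1 : IsConfining V) (h2 : IsRepulsiveInteraction v₀)
    (hA : EnergyConvergence β V v₀)
    (huniq1 : ∀ᶠ lam in 𝓝 (1 : ℝ), HasUniqueNlsMinimizer V (coupling v₀) lam 1)
    (huniq2 : ∀ᶠ lam in 𝓝 (1 : ℝ), HasUniqueNlsMinimizer V (coupling v₀) 1 lam)
    (Ψ : ∀ N : ℕ, Config N → ℂ)
    (hΨ : ∀ N : ℕ, 2 ≤ N → IsGroundState V (pairPotential β v₀ N) (Ψ N))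
    (φ : R3 → ℂ) (hφ : IsNlsMinimizer V (coupling v₀) 1 1 φ) :
    Tendsto (fun n : ℕ => kineticAt (Ψ (n + 2)) 0) atTop (𝓝 (kinetic φ)) ∧
    Tendsto (fun n : ℕ => potentialAt V (Ψ (n + 2)) 0) atTop (𝓝 (potential V φ)) ∧
    Tendsto (fun n : ℕ => (1 / 2) *
        ∑ j ∈ Finset.univ.erase (0 : Fin (n + 2)),
          interactionAt (pairPotential β v₀ (n + 2)) (Ψ (n + 2)) 0 j)
      atTop (𝓝 (coupling v₀ * quartic φ)) := by
  set g := coupling v₀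
  have hg : 0 ≤ g := coupling_nonneg h2.nonneg
  set K : ℕ → ℝ := fun n => kineticAt (Ψ (n + 2)) 0
  set P : ℕ → ℝ := fun n => potentialAt V (Ψ (n + 2)) 0
  set I : ℕ → ℝ := fun n => (1 / 2) * ∑ j ∈ Finset.univ.erase (0 : Fin (n + 2)),
    interactionAt (pairPotential β v₀ (n + 2)) (Ψ (n + 2)) 0 j
  have hgs : ∀ n, IsGroundState V (pairPotential β v₀ (n + 2)) (Ψ (n + 2)) := fun n =>
    hΨ _ (by omega)
  set e : ℝ → ℝ → ℕ → ℝ := fun a b n =>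
    nBodyMinEnergy (n + 2) V (pairPotential β v₀ (n + 2)) a b / ((n + 2 : ℕ) : ℝ)
  have hpos : ∀ n : ℕ, (0 : ℝ) < ((n + 2 : ℕ) : ℝ) := fun n => by positivity
  -- The ground state for a = b = 1 is the trial state; a, b ≥ 0 keeps the energies bounded below,
  -- as the infimum requires.
  have hle : ∀ a b, 0 ≤ a → 0 ≤ b → ∀ n, e a b n ≤ K n + a * P n + b * I n := by
    intro a b ha hb n
    rw [div_le_iff₀ (hpos n), mul_comm]
    exact (nBodyMinEnergy_le (fun x => (h1.pos x).le)
      (pairPotential_nonneg β h2.nonneg (by omega)) ha hb (hgs n).1).trans_eq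
      (nBodyEnergy_eq (hgs n).1 a b)
  have heq : ∀ n, e 1 1 n = K n + P n + I n := by
    intro n
    have h := nBodyEnergy_eq (hgs n).1 1 1
    rw [← (hgs n).nBodyMinEnergy_eq] at h
    rw [div_eq_iff (hpos n).ne', mul_comm, h]
    simp only [one_mul]
    rfl
  have hA1 : ∀ᶠ l in 𝓝 (1 : ℝ), Tendsto (fun n => e l 1 n) atTop (𝓝 (nlsMinEnergy V g l 1)) :=
    hA.1.mono fun l h => h.comp (tendsto_add_atTop_nat 2)
  have hA2 : ∀ᶠ l in 𝓝 (1 : ℝ), Tendsto (fun n => e 1 l n) atTop (𝓝 (nlsMinEnergy V g 1 l)) :=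
    hA.2.mono fun l h => h.comp (tendsto_add_atTop_nat 2)
  have hl0 : ∀ᶠ l in 𝓝 (1 : ℝ), 0 ≤ l := (lt_mem_nhds zero_lt_one).mono fun l h => h.le
  have hK0 := kinetic_nonneg
  have hP0 := potential_nonneg h1.pos
  have hQ0 : ∀ f, 0 ≤ g * quartic f := fun f => mul_nonneg hg (quartic_nonneg f)
  have hmin := @tendsto_of_minimizing_sequence _ h1 _ hg _ hφ huniq1.self_of_nhds
  have hP : Tendsto P atTop (𝓝 (potential V φ)) := by
    obtain ⟨q, hq, hqE⟩ := exists_supergradient (S := nlsStates V)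
      (E := fun l => nlsEnergy V g l 1) (W := potential V)
      (fun l f => by simp only [nlsEnergy]; ring) hP0
      (fun f => by simp only [nlsEnergy]; linarith [hK0 f, hQ0 f]) hφ.1 hφ.2
      (huniq1.mono fun l h => h.1) fun f hf hlim => (hmin hf hlim).1
    refine tendsto_supergradient (e := fun n l => e l 1 n) hA1 ?_ hqE hq
    filter_upwards [hl0] with l hl n
    rw [heq]
    linarith [hle l 1 hl zero_le_one n]
  have hI : Tendsto I atTop (𝓝 (g * quartic φ)) := by
    obtain ⟨q, hq, hqE⟩ := exists_supergradient (S := nlsStates V)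
      (E := fun l => nlsEnergy V g 1 l) (W := fun f => g * quartic f)
      (fun l f => by simp only [nlsEnergy]; ring) hQ0
      (fun f => by simp only [nlsEnergy]; linarith [hK0 f, hP0 f]) hφ.1 hφ.2
      (huniq2.mono fun l h => h.1) fun f hf hlim => (hmin hf hlim).2
    refine tendsto_supergradient (e := fun n l => e 1 l n) hA2 ?_ hqE hq
    filter_upwards [hl0] with l hl n
    rw [heq]
    linarith [hle 1 l zero_le_one hl n]
  refine ⟨?_, hP, hI⟩
  -- The kinetic energy is the total energy per particle minus the two parts whose limits are known.
  have hE := hA1.self_of_nhds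
  rw [hφ.nlsMinEnergy_eq] at hE
  convert! (hE.sub hP).sub hI using 2
  · rw [heq]; ring
  · simp only [nlsEnergy, one_mul]; ring
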